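/- Let $q$ be a complex number with $0<|q|<1$. Put $(x;q)_\infty=\prod_{n\ge 0}(1-xq^n)$, $(x;q)_n=(x;q)_\infty/(xq^n;q)_\infty$ for $n\in\mathbb Z$ (that is, $\prod_{j=0}^{n-1}(1-xq^j)$ for $n\ge 0$ and $\prod_{j=1}^{-n}(1-xq^{-j})^{-1}$ for $n<0$), $(x_1,\dots,x_m;q)_n=\prod_i (x_i;q)_n$ (also for $n=\infty$), $$\theta(x)=\frac1{(q;q)_\infty}\sum_{n=-\infty}^\infty(-1)^nq^{n(n-1)/2}x^n\quad(x\ne 0),\qquad \theta(x_1,\dots,x_m)=\prod_i\theta(x_i),$$ $$\Omega(x_1,\dots,x_n;a_1,\dots,a_m)=\prod_{i=1}^n\prod_{j=1}^m (x_i/a_j;q)_\infty .$$ For $A\ne0$ the very-well-poised series are $${}_8W_7[A;p_1,\dots,p_5;q,w]=\sum_{n=0}^\infty\frac{(A,q\sqrt A,-q\sqrt A,p_1,\dots,p_5;q)_n}{(q,\sqrt A,-\sqrt A,Aq/p_1,\dots,Aq/p_5;q)_n}\,w^n,$$ $${}_8\psi_8[A;p_1,\dots,p_6;q,w]=\sum_{n=-\infty}^\infty\frac{(q\sqrt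 A,-q\sqrt A,p_1,\dots,p_6;q)_n}{(\sqrt A,-\sqrt A,Aq/p_1,\dots,Aq/p_6;q)_n}\,w^n.$$ Let $a,b,c,d,e,h,k,z$ be nonzero complex numbers such that $$\Big|\frac{a^3q^2}{bcdehk}\Big|<1 ,$$ and such that no denominator in the formulas below vanishes; explicitly: none of $a,\ z,\ z/a,\ z^2/a$ is an integer power of $q$; $\frac{b^2}{a}q^{2n}\ne1$ for all integers $n\ge 0$; $\Omega(q,aq,aq/z,zq;b,c,d,e,h,k)\ne0$; and $\Omega(aq/b,bq;c,d,e,h,k)\neq0$. Then the three series below converge absolutely and $$\begin{aligned} {}_8W_7\Big[\frac{b^2}{a};\frac{bc}{a},\frac{bd}{a},\frac{be}{a},\frac{bh}{a},\frac{bk}{a};q,\frac{a^3q^2}{bcdehk}\Big] &=\lambda_1\;{}_8\psi_8\Big[a;b,c,d,e,h,k;q,\frac{a^3q^2}{bcdehk}\Big]\\ &\quad+\mu_1\;{}_8\psi_8\Big[\frac{z^2}{a};\frac{bz}{a},\frac{cz}{a},\frac{dz}{a},\frac{ez}{a},\frac{hz}{a},\frac{kz}{a};q,\frac{a^3q^2}{bcdehk}\Big],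 \end{aligned}$$ where $$\lambda_1=\frac{(b^2q/a;q)_\infty}{(q,aq,q/a;q)_\infty}\,\frac{\Omega(q,aq;b,c,d,e,h,k)}{\Omega(aq/b,bq;c,d,e,h,k)}\,\frac{\theta(bz/a,z/b)}{\theta(z/a,z)},$$ $$\mu_1=\frac{(b^2q/a;q)_\infty}{(q,z^2q/a,aq/z^2;q)_\infty}\,\frac{\Omega(aq/z,zq;b,c,d,e,h,k)}{\Omega(aq/b,bq;c,d,e,h,k)}\,\frac{\theta(a/b,b)}{\theta(a/z,z)}.$$ -/

import Mathlib

namespace QSeries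

noncomputable section

/-- The infinite `q`-shifted factorial `(x;q)_∞ = ∏_{n ≥ 0} (1 - x q^n)`. -/
def qInf (q x : ℂ) : ℂ := ∏' n : ℕ, (1 - x * q ^ n)

/-- The multi-parameter symbol `(x₁, …, x_m; q)_∞`. -/
def qInfL (q : ℂ) (xs : List ℂ) : ℂ := (xs.map (qInf q)).prod

/-- The `q`-shifted factorial `(x;q)_n` for an integer `n`:
`(1 - x)(1 - xq)⋯(1 - xq^{n-1})` for `n ≥ 0`, and
`1 / ((1 - xq⁻¹)(1 - xq⁻²)⋯(1 - xq^{n}))` for `n < 0`.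
It is the quotient `(x;q)_∞ / (q^n x;q)_∞`, see `qPoch_eq_div`, with the usual finite-product
meaning where that quotient would read `0 / 0`. -/
def qPoch (q x : ℂ) : ℤ → ℂ
  | Int.ofNat n => ∏ j ∈ Finset.range n, (1 - x * q ^ j)
  | Int.negSucc n => (∏ j ∈ Finset.range (n + 1), (1 - x * (q ^ (j + 1))⁻¹))⁻¹

/-- The multi-parameter symbol `(x₁, …, x_m; q)_n`. -/
def qPochL (q : ℂ) (xs : List ℂ) (n : ℤ) : ℂ := (xs.map fun x => qPoch q x n).prod

/-- The Jacobi theta function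
`θ(x) = (q;q)_∞⁻¹ ∑_{n ∈ ℤ} (-1)^n q^{n(n-1)/2} x^n` (for `x ≠ 0`). -/
def theta (q x : ℂ) : ℂ :=
  (qInf q q)⁻¹ * ∑' n : ℤ, (-1 : ℂ) ^ n * q ^ (n * (n - 1) / 2) * x ^ n

/-- The multi-parameter symbol `θ(x₁, …, x_m)`. -/
def thetaL (q : ℂ) (xs : List ℂ) : ℂ := (xs.map (theta q)).prod

/-- `Ω(x₁, …, x_n; a₁, …, a_m) = ∏_i ∏_j (x_i / a_j; q)_∞`. -/
def Omega (q : ℂ) (xs as : List ℂ) : ℂ :=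
  (xs.map fun x => (as.map fun a => qInf q (x / a)).prod).prod

/-- The `n`-th term of the unilateral series `ᵣ₊₁φᵣ[as; bs; q, w]`. -/
def phiTerm (q : ℂ) (as bs : List ℂ) (w : ℂ) (n : ℕ) : ℂ :=
  qPochL q as n / qPochL q bs n * (w ^ n / qPoch q q n)

/-- The `n`-th term of the bilateral series `ᵣψᵣ[as; bs; q, w]`. -/
def psiTerm (q : ℂ) (as bs : List ℂ) (w : ℂ) (n : ℤ) : ℂ :=
  qPochL q as n / qPochL q bs n * w ^ n

/-- The parameters `q√a, -q√a, p₁, p₂, …` of a very-well-poised series. The two choices of the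
square root give the same list up to order. -/
def vwpUpper (q a : ℂ) (ps : List ℂ) : List ℂ :=
  q * a ^ (1 / 2 : ℂ) :: -(q * a ^ (1 / 2 : ℂ)) :: ps

/-- The matching lower parameters `aq / α`, for `α` in `vwpUpper q a ps`. -/
def vwpLower (q a : ℂ) (ps : List ℂ) : List ℂ :=
  (vwpUpper q a ps).map fun α => a * q / α

/-- The `n`-th term of the very-well-poised series `ᵣ₊₁Wᵣ[a; ps; q, w]`
(of type `₈W₇` when `ps` has five entries). -/
def WTerm (q a : ℂ) (ps : List ℂ) (w : ℂ) : ℕ → ℂ :=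
  phiTerm q (a :: vwpUpper q a ps) (vwpLower q a ps) w

/-- The very-well-poised series `ᵣ₊₁Wᵣ[a; ps; q, w]`. -/
def W (q a : ℂ) (ps : List ℂ) (w : ℂ) : ℂ := ∑' n : ℕ, WTerm q a ps w n

/-- The `n`-th term of the very-well-poised bilateral series `ᵣψᵣ[a; ps; q, w]`
(of type `₈ψ₈` when `ps` has six entries). -/
def vwpPsiTerm (q a : ℂ) (ps : List ℂ) (w : ℂ) : ℤ → ℂ :=
  psiTerm q (vwpUpper q a ps) (vwpLower q a ps) w

/-- The very-well-poised bilateral series `ᵣψᵣ[a; ps; q, w]`. -/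
def vwpPsi (q a : ℂ) (ps : List ℂ) (w : ℂ) : ℂ := ∑' n : ℤ, vwpPsiTerm q a ps w n

/-- The coefficient `λ₁`. -/
def lambda₁ (q a b c d e h k z : ℂ) : ℂ :=
  qInf q (b ^ 2 * q / a) / qInfL q [q, a * q, q / a]
    * (Omega q [q, a * q] [b, c, d, e, h, k] / Omega q [a * q / b, b * q] [c, d, e, h, k])
    * (thetaL q [b * z / a, z / b] / thetaL q [z / a, z])

/-- The coefficient `μ₁`. -/
def mu₁ (q a b c d e h k z : ℂ) : ℂ :=
  qInf q (b ^ 2 * q / a) / qInfL q [q, z ^ 2 * q / a, a * q / z ^ 2]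
    * (Omega q [a * q / z, z * q] [b, c, d, e, h, k]
        / Omega q [a * q / b, b * q] [c, d, e, h, k])
    * (thetaL q [a / b, b] / thetaL q [a / z, z])

theorem multipliable_qInf {q : ℂ} (hq : ‖q‖ < 1) (x : ℂ) :
    Multipliable fun n : ℕ => 1 - x * q ^ n := by
  have h : Summable fun n : ℕ => ‖-(x * q ^ n)‖ := by
    simpa [norm_mul, norm_pow] using
      (summable_geometric_of_lt_one (norm_nonneg q) hq).mul_left ‖x‖
  simpa [sub_eq_add_neg] using multipliable_one_add_of_summable h

/-- `(x;q)_{n} (q^n x;q)_∞ = (x;q)_∞` for natural `n`. -/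
theorem prod_mul_qInf {q : ℂ} (hq : ‖q‖ < 1) (x : ℂ) (n : ℕ) :
    (∏ j ∈ Finset.range n, (1 - x * q ^ j)) * qInf q (q ^ n * x) = qInf q x := by
  have e : (fun j : ℕ => 1 - q ^ n * x * q ^ j) = fun j => 1 - x * q ^ (j + n) := by
    funext j; ring
  have h := multipliable_qInf hq (q ^ n * x)
  rw [e] at h
  unfold qInf
  rw [e]
  exact Multipliable.prod_mul_tprod_nat_mul' (f := fun j : ℕ => 1 - x * q ^ j) h

/-- The quotient form of the `q`-shifted factorial. -/
theorem qPoch_eq_div {q : ℂ} (hq0 : q ≠ 0) (hq : ‖q‖ < 1) (x : ℂ) (n : ℤ)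
    (hx : qInf q x ≠ 0) (hn : qInf q (q ^ n * x) ≠ 0) :
    qPoch q x n = qInf q x / qInf q (q ^ n * x) := by
  cases n with
  | ofNat n =>
    rw [eq_div_iff hn]
    simpa [qPoch] using prod_mul_qInf hq x n
  | negSucc n =>
    have h := prod_mul_qInf hq (q ^ (Int.negSucc n) * x) (n + 1)
    have e1 : q ^ (n + 1) * (q ^ (Int.negSucc n) * x) = x := by
      rw [zpow_negSucc]; field_simp
    rw [e1, ← Finset.prod_range_reflect] at h
    have e2 : ∀ j ∈ Finset.range (n + 1),
        1 - q ^ (Int.negSucc n) * x * q ^ (n + 1 - 1 - j) = 1 - x * (q ^ (j + 1))⁻¹ := by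
      intro j hj
      have hj' : j ≤ n := by simpa [Nat.lt_succ_iff] using hj
      obtain ⟨m, rfl⟩ := Nat.exists_eq_add_of_le hj'
      have : j + m + 1 - 1 - j = m := by omega
      rw [this, zpow_negSucc]
      field_simp
      ring
    rw [Finset.prod_congr rfl e2] at h
    simp only [qPoch]
    rw [← h]
    have : (∏ j ∈ Finset.range (n + 1), (1 - x * (q ^ (j + 1))⁻¹)) ≠ 0 := by
      intro h0; rw [h0, zero_mul] at h; exact hn h.symm
    field_simp

end

end QSeries

namespace QSeries

open Filter Topology

noncomputable section

/-! ### The q-shifted factorial `(x;q)_∞` and the product form of theta -/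

section Basics

variable {q : ℂ}

/-! All three series are values of one function of a base point `x ∈ ℂˣ`. Summing a very-well-poised
summand over the points `x q^n`, with all denominators cleared, gives `wpSum q a p x`. At `x = a`
and `x = z` this is a multiple of the two ₈ψ₈ series. At `x = b` the factor attached to the
parameter `b` kills every term with `n < 0`, and a multiple of the ₈W₇ remains.

The function is holomorphic on `ℂˣ`. Shifting `n` by one gives it the multiplier of a theta function
of degree six, and `n ↦ -n` makes it odd under `x ↦ a / x` (`IsOddTheta`). Oddness forces zeros
wherever `x² ∈ a q^ℤ`, hence a factor `θ(x² / a)`, of degree four. What is left is an even theta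
function of degree two, so the space of candidates is two-dimensional and the values at `a` and `z`
are coordinates on it (`IsOddTheta.eq_zero`). Interpolating with explicit theta products gives
`IsOddTheta.connection`, and `x = b` gives the theorem.

The analytic input is a Liouville argument: two holomorphic functions on `ℂˣ` with the same
multiplier are proportional once the first vanishes at the zeros, all simple, of the second
(`exists_eq_const_mul`). The same principle identifies the theta series with its product form up to
a constant.

At `x = b` both sides contain `(aq/b²;q)_∞`, which may vanish although the theorem still holds. It
is cancelled for generic `b`, and `uniSum_connection` reaches the remaining `b` by continuity. -/

theorem qInf_eq_mul (hq : ‖q‖ < 1) (x : ℂ) : qInf q x = (1 - x) * qInf q (q * x) := by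
  simpa using (prod_mul_qInf hq x 1).symm

theorem summable_norm_mul_pow (hq : ‖q‖ < 1) (x : ℂ) : Summable fun n : ℕ => ‖-(x * q ^ n)‖ := by
  simpa [norm_mul, norm_pow] using
    (summable_geometric_of_lt_one (norm_nonneg q) hq).mul_left ‖x‖

theorem qInf_ne_zero (hq : ‖q‖ < 1) {x : ℂ} (h : ∀ n : ℕ, x * q ^ n ≠ 1) : qInf q x ≠ 0 := by
  have := tprod_one_add_ne_zero_of_summable (f := fun n : ℕ => -(x * q ^ n))
    (fun n h0 => h n (by linear_combination -h0)) (summable_norm_mul_pow hq x)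
  simpa [qInf, sub_eq_add_neg] using this

theorem exists_of_qInf_eq_zero (hq : ‖q‖ < 1) {x : ℂ} (h : qInf q x = 0) :
    ∃ n : ℕ, x * q ^ n = 1 := by
  by_contra! h'
  exact qInf_ne_zero hq h' h

theorem qInf_eq_zero (hq : ‖q‖ < 1) {x : ℂ} {n : ℕ} (h : x * q ^ n = 1) : qInf q x = 0 := by
  rw [← prod_mul_qInf hq x (n + 1), Finset.prod_eq_zero (Finset.self_mem_range_succ n), zero_mul]
  rw [h, sub_self]

theorem qInf_q_ne_zero (hq : ‖q‖ < 1) : qInf q q ≠ 0 := by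
  refine qInf_ne_zero hq fun n h => ?_
  have : ‖q * q ^ n‖ < 1 := by
    rw [← pow_succ', norm_pow]
    exact pow_lt_one₀ (norm_nonneg _) hq (by omega)
  rw [h, norm_one] at this
  exact lt_irrefl _ this

/-- From `1 + t ≤ exp t` and the geometric series. The bound does not depend on `n`, so it passes to
the infinite product and serves in all the majorants below. -/
theorem norm_prod_one_sub_le (hq : ‖q‖ < 1) (x : ℂ) (n : ℕ) :
    ‖∏ j ∈ Finset.range n, (1 - x * q ^ j)‖ ≤ Real.exp (‖x‖ / (1 - ‖q‖)) := by
  rw [norm_prod]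
  calc ∏ j ∈ Finset.range n, ‖1 - x * q ^ j‖
      ≤ ∏ j ∈ Finset.range n, Real.exp (‖x‖ * ‖q‖ ^ j) := by
        refine Finset.prod_le_prod (fun _ _ => norm_nonneg _) fun j _ => ?_
        calc ‖1 - x * q ^ j‖ ≤ ‖(1 : ℂ)‖ + ‖x * q ^ j‖ := norm_sub_le _ _
          _ = ‖x‖ * ‖q‖ ^ j + 1 := by rw [norm_one, norm_mul, norm_pow, add_comm]
          _ ≤ _ := Real.add_one_le_exp _
    _ = Real.exp (‖x‖ * ∑ j ∈ Finset.range n, ‖q‖ ^ j) := by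
        rw [← Real.exp_sum, Finset.mul_sum]
    _ ≤ _ := by
        rw [div_eq_mul_inv, ← tsum_geometric_of_lt_one (norm_nonneg q) hq]
        gcongr
        exact (summable_geometric_of_lt_one (norm_nonneg q) hq).sum_le_tsum _
          (fun _ _ => by positivity)

theorem norm_qInf_le (hq : ‖q‖ < 1) (x : ℂ) : ‖qInf q x‖ ≤ Real.exp (‖x‖ / (1 - ‖q‖)) := by
  have h := ((multipliable_qInf hq x).hasProd.tendsto_prod_nat).norm
  exact le_of_tendsto' h fun n => norm_prod_one_sub_le hq x n

theorem norm_qInf_le_of_le (hq : ‖q‖ < 1) {x : ℂ} {r : ℝ} (h : ‖x‖ ≤ r) :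
    ‖qInf q x‖ ≤ Real.exp (r / (1 - ‖q‖)) :=
  (norm_qInf_le hq x).trans <| by
    have : 0 < 1 - ‖q‖ := sub_pos.2 hq
    gcongr

theorem differentiable_qInf (hq : ‖q‖ < 1) : Differentiable ℂ (qInf q) := by
  intro x
  have hu : Summable fun n : ℕ => (‖x‖ + 1) * ‖q‖ ^ n :=
    (summable_geometric_of_lt_one (norm_nonneg q) hq).mul_left _
  have hK : IsOpen (Metric.ball (0 : ℂ) (‖x‖ + 1)) := Metric.isOpen_ball
  have h := hu.hasProdLocallyUniformlyOn_nat_one_add (f := fun n y => -(y * q ^ n)) hK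
    (Eventually.of_forall fun n y hy => by
      rw [norm_neg, norm_mul, norm_pow]
      have : ‖y‖ < ‖x‖ + 1 := by simpa using hy
      gcongr) (fun n => by fun_prop)
  have h2 : DifferentiableOn ℂ (fun y => ∏' n : ℕ, (1 + -(y * q ^ n)))
      (Metric.ball (0 : ℂ) (‖x‖ + 1)) :=
    h.differentiableOn (Eventually.of_forall fun s => by fun_prop) hK
  have h3 := h2.differentiableAt (hK.mem_nhds (x := x) (by simp))
  have e : qInf q = fun y => ∏' n : ℕ, (1 + -(y * q ^ n)) := by
    funext y; simp [qInf, sub_eq_add_neg]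
  rwa [e]

theorem continuous_qInf (hq : ‖q‖ < 1) : Continuous (qInf q) := (differentiable_qInf hq).continuous

/-- Reflection of `(y q⁻ⁿ; q)_∞`. -/
theorem qInf_mul_zpow_neg (hq0 : q ≠ 0) (hq : ‖q‖ < 1) {y : ℂ} (hy : y ≠ 0) (n : ℕ) :
    qInf q (y * q ^ (-(n : ℤ))) * q ^ (n * (n + 1) / 2)
      = (-y) ^ n * (∏ j ∈ Finset.range n, (1 - q / y * q ^ j)) * qInf q y := by
  induction n with
  | zero => simp
  | succ n ih =>
    have e : (n + 1) * (n + 1 + 1) / 2 = n * (n + 1) / 2 + (n + 1) := by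
      rw [show (n + 1) * (n + 1 + 1) = n * (n + 1) + (n + 1) * 2 by ring,
        Nat.add_mul_div_right _ _ (by norm_num)]
    rw [qInf_eq_mul hq, e, pow_add, Finset.prod_range_succ, pow_succ (-y)]
    have e2 : q * (y * q ^ (-((n + 1 : ℕ) : ℤ))) = y * q ^ (-(n : ℤ)) := by
      rw [show -(n : ℤ) = -((n + 1 : ℕ) : ℤ) + 1 by push_cast; ring, zpow_add_one₀ hq0]; ring
    rw [e2]
    have e3 : (1 - y * q ^ (-((n + 1 : ℕ) : ℤ))) * q ^ (n + 1) = -y * (1 - q / y * q ^ n) := by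
      rw [zpow_neg, zpow_natCast]; field_simp; ring
    linear_combination (-y * (1 - q / y * q ^ n)) * ih
      + (qInf q (y * q ^ (-(n : ℤ))) * q ^ (n * (n + 1) / 2)) * e3

/-- The product form `(y;q)_∞ (q/y;q)_∞` of the theta function. -/
def thetaProd (q y : ℂ) : ℂ := qInf q y * qInf q (q / y)

theorem thetaProd_q_mul (hq0 : q ≠ 0) (hq : ‖q‖ < 1) {y : ℂ} (hy : y ≠ 0) :
    thetaProd q (q * y) = -y⁻¹ * thetaProd q y := by
  have h1 := qInf_eq_mul hq y
  have h2 := qInf_eq_mul hq y⁻¹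
  have e : q / (q * y) = y⁻¹ := by field_simp
  rw [thetaProd, thetaProd, e, h1, h2, div_eq_mul_inv]
  field_simp
  ring

theorem thetaProd_div_q (hq0 : q ≠ 0) (hq : ‖q‖ < 1) {y : ℂ} (hy : y ≠ 0) :
    thetaProd q (y / q) = -(y / q) * thetaProd q y := by
  have h := thetaProd_q_mul hq0 hq (div_ne_zero hy hq0)
  rw [mul_div_cancel₀ _ hq0] at h
  rw [h]; field_simp

theorem thetaProd_q_div (hq0 : q ≠ 0) (y : ℂ) :
    thetaProd q (q / y) = thetaProd q y := by
  rw [thetaProd, thetaProd, div_div_cancel₀ hq0, mul_comm]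

theorem thetaProd_inv (hq0 : q ≠ 0) (hq : ‖q‖ < 1) {y : ℂ} (hy : y ≠ 0) :
    thetaProd q y⁻¹ = -y⁻¹ * thetaProd q y := by
  rw [← thetaProd_q_mul hq0 hq hy, ← thetaProd_q_div hq0 (q * y)]
  congr 1; field_simp

theorem thetaProd_one (hq : ‖q‖ < 1) : thetaProd q 1 = 0 := by
  rw [thetaProd, qInf_eq_zero hq (n := 0) (by simp), zero_mul]

theorem exists_of_thetaProd_eq_zero (hq0 : q ≠ 0) (hq : ‖q‖ < 1) {y : ℂ} (hy : y ≠ 0)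
    (h : thetaProd q y = 0) : ∃ m : ℤ, y = q ^ m := by
  rcases mul_eq_zero.1 h with h | h
  · obtain ⟨n, hn⟩ := exists_of_qInf_eq_zero hq h
    exact ⟨-n, by rw [zpow_neg, zpow_natCast]; exact eq_inv_of_mul_eq_one_left hn⟩
  · obtain ⟨n, hn⟩ := exists_of_qInf_eq_zero hq h
    refine ⟨n + 1, ?_⟩
    rw [zpow_add_one₀ hq0, zpow_natCast]
    field_simp at hn
    rw [← hn]; ring

theorem thetaProd_ne_zero (hq0 : q ≠ 0) (hq : ‖q‖ < 1) {y : ℂ} (hy : y ≠ 0)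
    (h : ∀ m : ℤ, y ≠ q ^ m) : thetaProd q y ≠ 0 := fun h0 =>
  let ⟨m, hm⟩ := exists_of_thetaProd_eq_zero hq0 hq hy h0
  h m hm

/-- Induction principle along the powers of `q`. -/
theorem zpow_induction (hq0 : q ≠ 0) {P : ℂ → Prop} (h1 : P 1)
    (h : ∀ x, x ≠ 0 → (P (q * x) ↔ P x)) (m : ℤ) : P (q ^ m) := by
  induction m with
  | zero => simpa using h1
  | succ n ih =>
    rw [zpow_add_one₀ hq0, mul_comm]
    exact (h _ (zpow_ne_zero _ hq0)).2 ih
  | pred n ih =>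
    refine (h _ (zpow_ne_zero _ hq0)).1 ?_
    rwa [mul_comm, ← zpow_add_one₀ hq0, sub_add_cancel]

theorem differentiableAt_thetaProd (hq : ‖q‖ < 1) {y : ℂ} (hy : y ≠ 0) :
    DifferentiableAt ℂ (thetaProd q) y := by
  have h := differentiable_qInf hq
  exact (h y).mul ((h (q / y)).comp y ((differentiableAt_const q).div differentiableAt_id hy))

/-- At `1` the simple factor `1 - y` splits off with cofactor `(q;q)_∞² ≠ 0`. Differentiating `θ(qy)
= -y⁻¹ θ(y)` at a zero carries simplicity between `x` and `q x`, hence to every power of `q`, and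
there are no other zeros. -/
theorem deriv_thetaProd_ne_zero (hq0 : q ≠ 0) (hq : ‖q‖ < 1) {y : ℂ} (hy : y ≠ 0)
    (h : thetaProd q y = 0) : deriv (thetaProd q) y ≠ 0 := by
  obtain ⟨m, rfl⟩ := exists_of_thetaProd_eq_zero hq0 hq hy h
  have key := zpow_induction (q := q)
    (P := fun x => thetaProd q x = 0 ∧ deriv (thetaProd q) x ≠ 0) hq0 ?_ ?_ m
  · exact key.2
  · refine ⟨thetaProd_one hq, ?_⟩
    have hd := differentiable_qInf hq
    have hg : DifferentiableAt ℂ (fun y => qInf q (q * y) * qInf q (q / y)) 1 := by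
      refine DifferentiableAt.mul ?_ ?_
      · exact (hd _).comp 1 (by fun_prop)
      · exact (hd _).comp 1 ((differentiableAt_const q).div differentiableAt_id one_ne_zero)
    have e : thetaProd q = fun y => (1 - y) * (qInf q (q * y) * qInf q (q / y)) := by
      funext y; rw [thetaProd, qInf_eq_mul hq y]; ring
    have h2 := (((hasDerivAt_id (1 : ℂ)).const_sub 1).mul hg.hasDerivAt)
    have h3 := h2.congr_of_eventuallyEq (f₁ := thetaProd q)
      (Eventually.of_forall fun y => by rw [e]; rfl)
    rw [h3.deriv]
    simp [qInf_q_ne_zero hq]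
  · intro x hx
    have hqx : q * x ≠ 0 := mul_ne_zero hq0 hx
    rw [thetaProd_q_mul hq0 hq hx]
    have e : (fun y => thetaProd q (q * y)) =ᶠ[𝓝 x] fun y => -y⁻¹ * thetaProd q y := by
      filter_upwards [isOpen_ne.mem_nhds hx] with y hy using thetaProd_q_mul hq0 hq hy
    have h1 : HasDerivAt (fun y => thetaProd q (q * y)) (deriv (thetaProd q) (q * x) * (q * 1)) x :=
      (differentiableAt_thetaProd hq hqx).hasDerivAt.comp x ((hasDerivAt_id x).const_mul q)
    have h2 := ((hasDerivAt_inv hx).neg.mul (differentiableAt_thetaProd hq hx).hasDerivAt)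
    have h3 := (h1.congr_of_eventuallyEq e.symm).unique h2
    have : -x⁻¹ * thetaProd q x = 0 ↔ thetaProd q x = 0 := by simp [hx]
    rw [this]
    refine and_congr_right fun h0 => ?_
    rw [h0, mul_zero, zero_add, mul_one] at h3
    constructor
    · intro h4 h5
      rw [h5, mul_zero] at h3
      exact (mul_ne_zero h4 hq0) h3
    · intro h4 h5
      rw [h5, zero_mul] at h3
      exact (mul_ne_zero (neg_ne_zero.2 (inv_ne_zero hx)) h4) h3.symm

end Basics

/-! ### Liouville-type rigidity for q-periodic functions on `ℂˣ` -/

section Periodic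

variable {q : ℂ}

theorem exists_zpow_mul_norm_mem (hq0 : q ≠ 0) (hq : ‖q‖ < 1) {x : ℂ} (hx : x ≠ 0) :
    ∃ m : ℤ, 1 ≤ ‖q ^ m * x‖ ∧ ‖q ^ m * x‖ ≤ ‖q‖⁻¹ := by
  have hq' : 0 < ‖q‖ := norm_pos_iff.2 hq0
  obtain ⟨m, hm1, hm2⟩ := exists_mem_Ico_zpow (norm_pos_iff.2 hx) ((one_lt_inv₀ hq').2 hq)
  refine ⟨m, ?_, ?_⟩
  · rw [norm_mul, norm_zpow]
    rw [inv_zpow] at hm1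
    have := zpow_pos hq' m
    calc (1 : ℝ) = ‖q‖ ^ m * (‖q‖ ^ m)⁻¹ := (mul_inv_cancel₀ this.ne').symm
      _ ≤ _ := by gcongr
  · rw [norm_mul, norm_zpow]
    rw [inv_zpow, zpow_add_one₀ hq'.ne', mul_inv] at hm2
    have := zpow_pos hq' m
    calc ‖q‖ ^ m * ‖x‖ ≤ ‖q‖ ^ m * ((‖q‖ ^ m)⁻¹ * ‖q‖⁻¹) := by gcongr
      _ = ‖q‖⁻¹ := by field_simp

/-- A `q`-periodic holomorphic function on `ℂˣ` is constant. -/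
theorem eq_of_qPeriodic (hq0 : q ≠ 0) (hq : ‖q‖ < 1) {f : ℂ → ℂ}
    (hf : DifferentiableOn ℂ f {0}ᶜ) (hper : ∀ x, x ≠ 0 → f (q * x) = f x) {x y : ℂ}
    (hx : x ≠ 0) (hy : y ≠ 0) : f x = f y := by
  have hper' : ∀ (m : ℤ) (x : ℂ), x ≠ 0 → f (q ^ m * x) = f x := by
    intro m x hx
    refine zpow_induction (P := fun u => f (u * x) = f x) hq0 (by simp) (fun u hu => ?_) m
    rw [mul_assoc, hper _ (mul_ne_zero hu hx)]
  -- The annulus `1 ≤ |x| ≤ |q|⁻¹` meets every `q`-orbit, so a bound there is a bound on `ℂˣ`. Then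
  -- `f ∘ exp` is bounded and entire.
  have hK : IsCompact (Metric.closedBall (0 : ℂ) ‖q‖⁻¹ \ Metric.ball 0 1) :=
    (isCompact_closedBall _ _).diff Metric.isOpen_ball
  obtain ⟨C, hC⟩ := hK.exists_bound_of_continuousOn (f := f) (hf.continuousOn.mono (by
    rintro x ⟨-, h⟩ rfl
    simp at h))
  have hbound : ∀ x, x ≠ 0 → ‖f x‖ ≤ C := by
    intro x hx
    obtain ⟨m, h1, h2⟩ := exists_zpow_mul_norm_mem hq0 hq hx
    rw [← hper' m x hx]
    exact hC _ ⟨by simpa using h2, by simpa using h1⟩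
  have hd : Differentiable ℂ fun w => f (Complex.exp w) := fun w =>
    ((hf.differentiableAt (isOpen_compl_singleton.mem_nhds (Complex.exp_ne_zero w))).comp w
      Complex.differentiableAt_exp)
  have hb : Bornology.IsBounded (Set.range fun w => f (Complex.exp w)) := by
    refine isBounded_iff_forall_norm_le.2 ⟨C, ?_⟩
    rintro _ ⟨w, rfl⟩
    exact hbound _ (Complex.exp_ne_zero w)
  have := hd.apply_eq_apply_of_bounded hb (Complex.log x) (Complex.log y)
  simpa [Complex.exp_log hx, Complex.exp_log hy] using this

/-- Division by a holomorphic function with simple zeros. -/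
theorem exists_eq_mul_of_simple_zeros {U : Set ℂ} (hU : IsOpen U) {E T : ℂ → ℂ}
    (hE : DifferentiableOn ℂ E U) (hT : DifferentiableOn ℂ T U)
    (h : ∀ x ∈ U, T x = 0 → E x = 0 ∧ deriv T x ≠ 0) :
    ∃ Q : ℂ → ℂ, DifferentiableOn ℂ Q U ∧ ∀ x ∈ U, E x = T x * Q x := by
  classical
  -- The value at a zero of `T` fills the removable singularity: nearby the quotient equals the
  -- ratio of the two `dslope`s, which are holomorphic, with nonzero denominator because the zero is
  -- simple.
  refine ⟨fun x => if T x = 0 then deriv E x / deriv T x else E x / T x, ?_, ?_⟩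
  · intro x hx
    refine DifferentiableAt.differentiableWithinAt ?_
    have hUx := hU.mem_nhds hx
    by_cases h0 : T x = 0
    · obtain ⟨hE0, hT0⟩ := h x hx h0
      have hdE := ((Complex.differentiableOn_dslope hUx).2 hE).differentiableAt hUx
      have hdT := ((Complex.differentiableOn_dslope hUx).2 hT).differentiableAt hUx
      have hne : dslope T x x ≠ 0 := by rwa [dslope_same]
      refine (hdE.div hdT hne).congr_of_eventuallyEq ?_
      filter_upwards [hdT.continuousAt.eventually_ne hne] with y hy
      rcases eq_or_ne y x with rfl | hyx
      · simp [h0, dslope_same]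
      · rw [dslope_of_ne _ hyx, slope_def_field, h0, sub_zero] at hy
        have hTy : T y ≠ 0 := fun h => hy (by rw [h, zero_div])
        have : y - x ≠ 0 := sub_ne_zero.2 hyx
        simp only [if_neg hTy, Pi.div_apply, dslope_of_ne _ hyx, slope_def_field, h0, hE0, sub_zero]
        field_simp
    · have hTx := hT.differentiableAt hUx
      refine ((hE.differentiableAt hUx).div hTx h0).congr_of_eventuallyEq ?_
      filter_upwards [hTx.continuousAt.eventually_ne h0] with y hy
      simp [hy]
  · intro x hx
    by_cases h0 : T x = 0
    · simp [h0, (h x hx h0).1]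
    · simp only [if_neg h0]
      field_simp

/-- Two holomorphic functions on `ℂˣ` with the same `q`-multiplier are proportional, if the
second has only simple zeros and the first vanishes there. -/
theorem exists_eq_const_mul (hq0 : q ≠ 0) (hq : ‖q‖ < 1) {E T m : ℂ → ℂ}
    (hE : DifferentiableOn ℂ E {0}ᶜ) (hT : DifferentiableOn ℂ T {0}ᶜ)
    (h : ∀ x, x ≠ 0 → T x = 0 → E x = 0 ∧ deriv T x ≠ 0)
    (hm : ∀ x, x ≠ 0 → m x ≠ 0) (hEm : ∀ x, x ≠ 0 → E (q * x) = m x * E x)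
    (hTm : ∀ x, x ≠ 0 → T (q * x) = m x * T x) :
    ∃ K : ℂ, ∀ x, x ≠ 0 → E x = K * T x := by
  have hU : IsOpen ({0}ᶜ : Set ℂ) := isOpen_compl_singleton
  obtain ⟨Q, hQ, hEQ⟩ := exists_eq_mul_of_simple_zeros hU hE hT h
  have hper1 : ∀ x, x ≠ 0 → T x ≠ 0 → Q (q * x) = Q x := by
    intro x hx hTx
    have h1 := hEm x hx
    rw [hEQ x hx, hEQ _ (mul_ne_zero hq0 hx), hTm x hx] at h1
    refine mul_left_cancel₀ (mul_ne_zero (hm x hx) hTx) (by rw [h1]; ring)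
  have hper : ∀ x, x ≠ 0 → Q (q * x) = Q x := by
    intro x hx
    by_cases hTx : T x = 0
    -- Zeros of `T` are isolated, so periodicity of `Q` extends to them by continuity.
    · have hev : ∀ᶠ y in 𝓝[≠] x, T y ≠ 0 :=
        ((hT.differentiableAt (hU.mem_nhds hx)).hasDerivAt.eventually_ne (h x hx hTx).2)
      have c1 : ContinuousAt (fun y => Q (q * y)) x :=
        ContinuousAt.comp (f := fun y => q * y)
          (hQ.differentiableAt (hU.mem_nhds (mul_ne_zero hq0 hx))).continuousAt (by fun_prop)
      have c2 : ContinuousAt Q x := (hQ.differentiableAt (hU.mem_nhds hx)).continuousAt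
      have hev2 : ∀ᶠ y in 𝓝[≠] x, Q y = Q (q * y) := by
        filter_upwards [hev, nhdsWithin_le_nhds (hU.mem_nhds hx)] with y hy hy0
        exact (hper1 y hy0 hy).symm
      exact tendsto_nhds_unique (c1.tendsto.mono_left nhdsWithin_le_nhds)
        ((c2.tendsto.mono_left nhdsWithin_le_nhds).congr' hev2)
    · exact hper1 x hx hTx
  refine ⟨Q 1, fun x hx => ?_⟩
  rw [hEQ x hx, eq_of_qPeriodic hq0 hq hQ hper hx one_ne_zero, mul_comm]

end Periodic

/-! ### Continuity and holomorphy of geometrically dominated series -/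

section GeometricSums

variable {ι : Type*} {v : ι → ℕ}

/-- The majorant varies with `y`, but continuity freezes it near a point, with ratio `(r y + 1) / 2
< 1`, which is what the Weierstrass test needs. The weight `v` is `n` for unilateral sums and `|n|`
for bilateral ones. -/
theorem eventually_geometric_bound {X : Type*} [TopologicalSpace X] {U : Set X} (hU : IsOpen U)
    {f : ι → X → ℂ} {B r : X → ℝ} (hB : ContinuousOn B U) (hr : ContinuousOn r U)
    (hB0 : ∀ y ∈ U, 0 ≤ B y) (hr0 : ∀ y ∈ U, 0 ≤ r y) (hr1 : ∀ y ∈ U, r y < 1)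
    (hfB : ∀ i, ∀ y ∈ U, ‖f i y‖ ≤ B y * r y ^ v i) {y : X} (hy : y ∈ U) :
    ∃ V : Set X, IsOpen V ∧ y ∈ V ∧ V ⊆ U ∧ ∃ C ρ : ℝ, 0 ≤ ρ ∧ ρ < 1 ∧
      ∀ i, ∀ z ∈ V, ‖f i z‖ ≤ C * ρ ^ v i := by
  have hUy := hU.mem_nhds hy
  have hr1' := hr1 y hy
  have h1 : ∀ᶠ z in 𝓝 y, z ∈ U ∧ B z < B y + 1 ∧ r z < (r y + 1) / 2 :=
    Filter.Eventually.and hUy (((hB.continuousAt hUy).eventually_lt_const (by linarith)).and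
      ((hr.continuousAt hUy).eventually_lt_const (by linarith)))
  obtain ⟨V, hVs, hVo, hyV⟩ := mem_nhds_iff.1 h1
  have h0 := hr0 y hy
  refine ⟨V, hVo, hyV, fun z hz => (hVs hz).1, B y + 1, (r y + 1) / 2, by linarith, by linarith,
    fun i z hz => ?_⟩
  obtain ⟨hzU, hzB, hzr⟩ := hVs hz
  refine (hfB i z hzU).trans ?_
  have := hr0 z hzU
  have := hB0 y hy
  gcongr

theorem continuousOn_tsum_geometric
    (hv : ∀ ρ : ℝ, 0 ≤ ρ → ρ < 1 → Summable fun i => ρ ^ v i)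
    {X : Type*} [TopologicalSpace X] {U : Set X} (hU : IsOpen U)
    {f : ι → X → ℂ} (hf : ∀ i, ContinuousOn (f i) U) {B r : X → ℝ}
    (hB : ContinuousOn B U) (hr : ContinuousOn r U)
    (hB0 : ∀ y ∈ U, 0 ≤ B y) (hr0 : ∀ y ∈ U, 0 ≤ r y) (hr1 : ∀ y ∈ U, r y < 1)
    (hfB : ∀ i, ∀ y ∈ U, ‖f i y‖ ≤ B y * r y ^ v i) :
    ContinuousOn (fun y => ∑' i, f i y) U := by
  intro y hy
  obtain ⟨V, hVo, hyV, hVU, C, ρ, h0, h1, hb⟩ :=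
    eventually_geometric_bound hU hB hr hB0 hr0 hr1 hfB hy
  exact ((continuousOn_tsum (fun i => (hf i).mono hVU) ((hv ρ h0 h1).mul_left C)
    hb).continuousAt (hVo.mem_nhds hyV)).continuousWithinAt

theorem differentiableOn_tsum_geometric
    (hv : ∀ ρ : ℝ, 0 ≤ ρ → ρ < 1 → Summable fun i => ρ ^ v i) {U : Set ℂ} (hU : IsOpen U)
    {f : ι → ℂ → ℂ} (hf : ∀ i, DifferentiableOn ℂ (f i) U) {B r : ℂ → ℝ}
    (hB : ContinuousOn B U) (hr : ContinuousOn r U)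
    (hB0 : ∀ y ∈ U, 0 ≤ B y) (hr0 : ∀ y ∈ U, 0 ≤ r y) (hr1 : ∀ y ∈ U, r y < 1)
    (hfB : ∀ i, ∀ y ∈ U, ‖f i y‖ ≤ B y * r y ^ v i) :
    DifferentiableOn ℂ (fun y => ∑' i, f i y) U := by
  intro y hy
  obtain ⟨V, hVo, hyV, hVU, C, ρ, h0, h1, hb⟩ :=
    eventually_geometric_bound hU hB hr hB0 hr0 hr1 hfB hy
  exact ((Complex.differentiableOn_tsum_of_summable_norm ((hv ρ h0 h1).mul_left C)
    (fun i => (hf i).mono hVU) hVo hb).differentiableAt (hVo.mem_nhds hyV)).differentiableWithinAt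

theorem summable_pow_natAbs {ρ : ℝ} (h0 : 0 ≤ ρ) (h1 : ρ < 1) :
    Summable fun n : ℤ => ρ ^ n.natAbs := by
  have := summable_geometric_of_lt_one h0 h1
  apply Summable.of_nat_of_neg <;> simpa using this

end GeometricSums

/-! ### The theta series and its product form -/

section Theta

variable {q : ℂ}

/-- The terms of the theta series. -/
def thetaTerm (q : ℂ) (n : ℤ) (x : ℂ) : ℂ := (-1 : ℂ) ^ n * q ^ (n * (n - 1) / 2) * x ^ n

theorem thetaExponent_add_one (n : ℤ) : (n + 1) * (n + 1 - 1) / 2 = n * (n - 1) / 2 + n := by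
  rw [show (n + 1) * (n + 1 - 1) = n * (n - 1) + n * 2 by ring, Int.add_mul_ediv_right _ _ (by norm_num)]

theorem thetaTerm_q_mul (hq0 : q ≠ 0) {x : ℂ} (hx : x ≠ 0) (n : ℤ) :
    thetaTerm q n (q * x) = -x⁻¹ * thetaTerm q (n + 1) x := by
  rw [thetaTerm, thetaTerm, thetaExponent_add_one, zpow_add₀ hq0, mul_zpow, zpow_add_one₀ hx,
    zpow_add_one₀ (by norm_num : (-1 : ℂ) ≠ 0)]
  field_simp

/-- Consecutive terms with `n ≥ 0` have ratio `ρ^n R → 0`. The half `n ≤ 0` is the same series with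
`ρ / R` in place of `R`. -/
theorem summable_geometric_triangular {ρ R : ℝ} (h0 : 0 < ρ) (h1 : ρ < 1) (hR : 0 < R) :
    Summable fun n : ℤ => ρ ^ (n * (n - 1) / 2) * R ^ n := by
  have key : ∀ R : ℝ, 0 < R → Summable fun n : ℕ => ρ ^ ((n : ℤ) * (n - 1) / 2) * R ^ (n : ℤ) := by
    intro R hR
    have hr : ∀ n : ℕ, ρ ^ (((n + 1 : ℕ) : ℤ) * ((n + 1 : ℕ) - 1) / 2) * R ^ ((n + 1 : ℕ) : ℤ)
        = (ρ ^ n * R) * (ρ ^ ((n : ℤ) * (n - 1) / 2) * R ^ (n : ℤ)) := by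
      intro n
      push_cast
      rw [thetaExponent_add_one, zpow_add₀ h0.ne', zpow_add_one₀ hR.ne', zpow_natCast ρ n]
      ring
    refine summable_of_ratio_test_tendsto_lt_one (l := 0) one_pos
      (Eventually.of_forall fun n => by positivity) ?_
    have : Tendsto (fun n : ℕ => ρ ^ n * R) atTop (𝓝 0) := by
      simpa using (tendsto_pow_atTop_nhds_zero_of_lt_one h0.le h1).mul_const R
    refine this.congr fun n => ?_
    rw [hr, norm_mul, mul_div_cancel_right₀ _ (norm_ne_zero_iff.2 (by positivity)),
      Real.norm_of_nonneg (by positivity)]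
  refine Summable.of_nat_of_neg (key R hR) ?_
  refine (key (ρ / R) (by positivity)).congr fun n => ?_
  have e : -(n : ℤ) * (-n - 1) / 2 = (n : ℤ) * (n - 1) / 2 + n := by
    rw [← thetaExponent_add_one]; congr 1; ring
  rw [e, zpow_add₀ h0.ne', div_zpow, zpow_neg, div_eq_mul_inv, mul_assoc]

theorem norm_thetaTerm (n : ℤ) (x : ℂ) :
    ‖thetaTerm q n x‖ = ‖q‖ ^ (n * (n - 1) / 2) * ‖x‖ ^ n := by
  simp [thetaTerm]

/-- The theta series, without its normalising factor. -/
def thetaSeries (q x : ℂ) : ℂ := ∑' n : ℤ, thetaTerm q n x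

theorem differentiableOn_thetaSeries (hq0 : q ≠ 0) (hq : ‖q‖ < 1) :
    DifferentiableOn ℂ (thetaSeries q) {0}ᶜ := by
  intro x hx
  have hx0 : 0 < ‖x‖ := norm_pos_iff.2 hx
  have hq' : 0 < ‖q‖ := norm_pos_iff.2 hq0
  have hVo : IsOpen {y : ℂ | ‖x‖ / 2 < ‖y‖ ∧ ‖y‖ < 2 * ‖x‖} :=
    (isOpen_lt continuous_const continuous_norm).inter (isOpen_lt continuous_norm continuous_const)
  have hxV : x ∈ {y : ℂ | ‖x‖ / 2 < ‖y‖ ∧ ‖y‖ < 2 * ‖x‖} := ⟨by linarith, by linarith⟩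
  -- For `|x|/2 < |y| < 2|x|`, `|y|^n` is dominated by the outer radius when `n ≥ 0` and by the
  -- inner one when `n ≤ 0`, so the sum of both series is a majorant.
  have hu := (summable_geometric_triangular hq' hq (R := ‖x‖ / 2) (by positivity)).add
    (summable_geometric_triangular hq' hq (R := 2 * ‖x‖) (by positivity))
  refine ((Complex.differentiableOn_tsum_of_summable_norm (F := fun n y => thetaTerm q n y)
    hu ?_ hVo ?_).differentiableAt
    (hVo.mem_nhds hxV)).differentiableWithinAt
  · intro n y hy
    have : y ≠ 0 := by
      rintro rfl
      have := hy.1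
      rw [norm_zero] at this
      linarith
    exact ((differentiableAt_zpow.2 (Or.inl this)).const_mul _).differentiableWithinAt
  · intro n y hy
    have hy0 : 0 < ‖y‖ := lt_trans (by positivity) hy.1
    rw [norm_thetaTerm, ← mul_add]
    gcongr
    have a1 := zpow_pos (show 0 < ‖x‖ / 2 by positivity) n
    have a2 := zpow_pos (show 0 < 2 * ‖x‖ by positivity) n
    rcases le_total 0 n with hn | hn
    · have := zpow_le_zpow_left₀ hn hy0.le hy.2.le
      linarith
    · have := zpow_le_zpow_left₀ (neg_nonneg.2 hn) (inv_nonneg.2 hy0.le)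
        (inv_anti₀ (show 0 < ‖x‖ / 2 by positivity) hy.1.le)
      rw [inv_zpow', inv_zpow', neg_neg] at this
      linarith

theorem thetaSeries_q_mul (hq0 : q ≠ 0) {x : ℂ} (hx : x ≠ 0) :
    thetaSeries q (q * x) = -x⁻¹ * thetaSeries q x := by
  rw [thetaSeries, thetaSeries, ← tsum_mul_left,
    ← (Equiv.addRight (1 : ℤ)).tsum_eq fun n => -x⁻¹ * thetaTerm q n x]
  exact tsum_congr fun n => thetaTerm_q_mul hq0 hx n

/-- The substitution `n ↦ 1 - n` preserves `n(n-1)/2` and flips the sign `(-1)^n`. -/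
theorem thetaSeries_one : thetaSeries q 1 = 0 := by
  have h : thetaSeries q 1 = -thetaSeries q 1 := by
    conv_lhs => rw [thetaSeries, ← (Equiv.subLeft (1 : ℤ)).tsum_eq]
    rw [thetaSeries, ← tsum_neg]
    refine tsum_congr fun n => ?_
    rw [Equiv.subLeft_apply, thetaTerm, thetaTerm, show (1 - n) * (1 - n - 1) = n * (n - 1) by ring,
      zpow_sub₀ (by norm_num), zpow_one, one_zpow, one_zpow]
    rcases Int.even_or_odd n with hn | hn
    · rw [hn.neg_one_zpow]; ring
    · rw [hn.neg_one_zpow]; ring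
  exact self_eq_neg.1 h

/-- Integrate the series times `x⁻¹` over the unit circle term by term: only `n = 0` survives and
contributes `2πi`, whereas a vanishing series would give `0`. -/
theorem thetaSeries_not_identically_zero (hq0 : q ≠ 0) (hq : ‖q‖ < 1) :
    ∃ x, x ≠ 0 ∧ thetaSeries q x ≠ 0 := by
  by_contra! h
  have hq' : 0 < ‖q‖ := norm_pos_iff.2 hq0
  have hc : ∀ θ : ℝ, circleMap 0 1 θ ≠ 0 := fun θ => circleMap_ne_center one_ne_zero
  let F : ℤ → C(ℝ, ℂ) := fun n =>
    ⟨fun θ => deriv (circleMap 0 1) θ • (thetaTerm q n (circleMap 0 1 θ) * (circleMap 0 1 θ)⁻¹), by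
      simp only [deriv_circleMap, thetaTerm]
      have h1 : Continuous (circleMap 0 1) := continuous_circleMap 0 1
      exact ((h1.mul continuous_const).smul ((continuous_const.mul
        (h1.zpow₀ n fun θ => Or.inl (hc θ))).mul (h1.inv₀ hc)))⟩
  have hF : ∀ n θ, ‖F n θ‖ = ‖q‖ ^ (n * (n - 1) / 2) * 1 ^ n := by
    intro n θ
    simp [F, norm_thetaTerm]
  have hs : Summable fun n => ‖(F n).restrict
      (⟨Set.uIcc 0 (2 * Real.pi), isCompact_uIcc⟩ : TopologicalSpace.Compacts ℝ)‖ := by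
    refine (summable_geometric_triangular hq' hq one_pos).of_nonneg_of_le
      (fun _ => norm_nonneg _) fun n => ?_
    refine (ContinuousMap.norm_le _ (by positivity)).2 fun θ => ?_
    exact (hF n θ).le
  have h1 := intervalIntegral.hasSum_intervalIntegral_of_summable_norm hs
  have h2 : ∀ θ : ℝ, ∑' n, F n θ = 0 := by
    intro θ
    have := h _ (hc θ)
    rw [thetaSeries] at this
    change ∑' n, deriv (circleMap 0 1) θ * (thetaTerm q n (circleMap 0 1 θ) * (circleMap 0 1 θ)⁻¹) = 0
    rw [tsum_mul_left, tsum_mul_right, this]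
    simp
  simp only [h2, intervalIntegral.integral_zero] at h1
  have h3 : ∀ n : ℤ, n ≠ 0 → ∫ θ in (0 : ℝ)..2 * Real.pi, F n θ = 0 := by
    intro n hn
    have := circleIntegral.integral_sub_zpow_of_ne (n := n - 1) (by omega) (0 : ℂ) 0 1
    rw [circleIntegral] at this
    have h4 : ∀ θ : ℝ, F n θ = (-1 : ℂ) ^ n * q ^ (n * (n - 1) / 2) *
        (deriv (circleMap 0 1) θ • (circleMap 0 1 θ - 0) ^ (n - 1)) := by
      intro θ
      rw [sub_zero, zpow_sub_one₀ (hc θ)]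
      simp only [F, thetaTerm, ContinuousMap.coe_mk, smul_eq_mul]
      ring
    simp only [h4]
    rw [intervalIntegral.integral_const_mul, this, mul_zero]
  have h4 := h1.unique (hasSum_single 0 h3)
  have h5 := circleIntegral.integral_sub_center_inv (0 : ℂ) (R := 1) one_ne_zero
  rw [circleIntegral] at h5
  simp only [F, thetaTerm, ContinuousMap.coe_mk] at h4
  simp only [sub_zero] at h5
  have h6 : 2 * (Real.pi : ℂ) * Complex.I = 0 := by
    refine h5.symm.trans (Eq.trans ?_ h4.symm)
    refine intervalIntegral.integral_congr fun θ _ => ?_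
    simp
  simp at h6

/-- The theta series is a constant multiple of its product form. -/
theorem exists_thetaSeries_eq (hq0 : q ≠ 0) (hq : ‖q‖ < 1) :
    ∃ K : ℂ, K ≠ 0 ∧ ∀ x, x ≠ 0 → thetaSeries q x = K * thetaProd q x := by
  have h0 : ∀ x, x ≠ 0 → thetaProd q x = 0 → thetaSeries q x = 0 := by
    intro x hx h0
    obtain ⟨m, rfl⟩ := exists_of_thetaProd_eq_zero hq0 hq hx h0
    refine zpow_induction (P := fun x => thetaSeries q x = 0) hq0 thetaSeries_one (fun x hx => ?_) m
    rw [thetaSeries_q_mul hq0 hx]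
    simp [hx]
  obtain ⟨K, hK⟩ := exists_eq_const_mul (m := fun x => -x⁻¹) hq0 hq
    (differentiableOn_thetaSeries hq0 hq)
    (fun x hx => (differentiableAt_thetaProd hq hx).differentiableWithinAt)
    (fun x hx hx0 => ⟨h0 x hx hx0, deriv_thetaProd_ne_zero hq0 hq hx hx0⟩)
    (fun x hx => neg_ne_zero.2 (inv_ne_zero hx)) (fun x hx => thetaSeries_q_mul hq0 hx)
    (fun x hx => thetaProd_q_mul hq0 hq hx)
  refine ⟨K, ?_, hK⟩
  rintro rfl
  obtain ⟨x, hx, h⟩ := thetaSeries_not_identically_zero hq0 hq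
  exact h (by rw [hK x hx, zero_mul])

/-- The Jacobi triple product up to a constant. Its value is irrelevant: theta enters `lambda₁` and
`mu₁` only through quotients with equally many factors above and below. -/
theorem exists_theta_eq (hq0 : q ≠ 0) (hq : ‖q‖ < 1) :
    ∃ K : ℂ, K ≠ 0 ∧ ∀ x, x ≠ 0 → theta q x = K * thetaProd q x := by
  obtain ⟨K, hK, h⟩ := exists_thetaSeries_eq hq0 hq
  refine ⟨(qInf q q)⁻¹ * K, mul_ne_zero (inv_ne_zero (qInf_q_ne_zero hq)) hK, fun x hx => ?_⟩
  rw [mul_assoc, ← h x hx]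
  rfl

end Theta

/-! ### The regularised bilateral sum: symmetries, convergence, holomorphy -/

section WellPoised

variable {q a x : ℂ} {p : Fin 6 → ℂ}

/-- The terms of the regularised very-well-poised bilateral sum with base point `x`. -/
def wpTerm (q a : ℂ) (p : Fin 6 → ℂ) (n : ℤ) (x : ℂ) : ℂ :=
  ((x * q ^ n)⁻¹ - x * q ^ n / a)
    * (∏ i, (qInf q (q * (x * q ^ n) / p i) * qInf q (a * q / (p i * (x * q ^ n)))))
    * q ^ (3 * n ^ 2) * (x ^ 2 / a) ^ (3 * n)

/-- The regularised very-well-poised bilateral sum. -/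
def wpSum (q a : ℂ) (p : Fin 6 → ℂ) (x : ℂ) : ℂ := ∑' n : ℤ, wpTerm q a p n x

/-- The argument of the series. -/
def wpArg (q a : ℂ) (p : Fin 6 → ℂ) : ℂ := a ^ 3 * q ^ 2 / ∏ i, p i

/-- With `t = (a/x) q^n`, the point `x q^{-n}` is `a / t`. The map `t ↦ a / t` swaps the two
q-factorials of each parameter and negates `t⁻¹ - t / a`. -/
theorem wpTerm_neg (hq0 : q ≠ 0) (ha : a ≠ 0) (hx : x ≠ 0) (n : ℤ) :
    wpTerm q a p (-n) x = -wpTerm q a p n (a / x) := by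
  have hqn : q ^ n ≠ 0 := zpow_ne_zero _ hq0
  have e1 : x * q ^ (-n) = a / (a / x * q ^ n) := by rw [zpow_neg]; field_simp
  have e2 : (x ^ 2 / a) ^ (3 * -n) = ((a / x) ^ 2 / a) ^ (3 * n) := by
    rw [mul_neg, zpow_neg, ← inv_zpow]; congr 1; field_simp
  have ht : a / x * q ^ n ≠ 0 := mul_ne_zero (div_ne_zero ha hx) hqn
  rw [wpTerm, wpTerm, e1, e2, neg_sq]
  generalize a / x * q ^ n = t at ht
  have e3 : ∏ i, (qInf q (q * (a / t) / p i) * qInf q (a * q / (p i * (a / t))))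
      = ∏ i, (qInf q (q * t / p i) * qInf q (a * q / (p i * t))) := by
    refine Finset.prod_congr rfl fun i _ => ?_
    rw [mul_comm]
    congr 2
    · rw [← div_div, mul_div_right_comm, mul_comm q t, mul_div_right_comm]
      rw [div_mul_eq_mul_div, div_div_eq_mul_div]
      field_simp
    · rw [← div_div, div_right_comm]; ring
  rw [e3]
  field_simp
  ring

/-- Reflecting the six factors `(aq/(p_i x q^m);q)_∞` by `qInf_mul_zpow_neg` costs `q^{-3m(m+1)}`.
The Gaussian factor `q^{3m²}` of `wpTerm` absorbs the quadratic part, and the remaining powers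
assemble to `wpArg ^ m`, so the decay is geometric. -/
theorem wpTerm_natCast (hq0 : q ≠ 0) (hq : ‖q‖ < 1) (ha : a ≠ 0) (hx : x ≠ 0)
    (hp : ∀ i, p i ≠ 0) (m : ℕ) :
    wpTerm q a p m x = x⁻¹ * (1 - x ^ 2 / a * q ^ (2 * m)) * wpArg q a p ^ m
      * ∏ i, (qInf q (x * q / p i * q ^ m) * (∏ j ∈ Finset.range m, (1 - x * p i / a * q ^ j))
        * qInf q (a * q / (p i * x))) := by
  have hqm : q ^ m ≠ 0 := pow_ne_zero _ hq0
  have hP : ∏ i, p i ≠ 0 := Finset.prod_ne_zero_iff.2 fun i _ => hp i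
  have h1 : ∀ i, qInf q (a * q / (p i * (x * q ^ m))) * q ^ (m * (m + 1) / 2)
      = (-(a * q / x) / p i) ^ m * ((∏ j ∈ Finset.range m, (1 - x * p i / a * q ^ j))
        * qInf q (a * q / (p i * x))) := by
    intro i
    have hpi := hp i
    have hy : a * q / (p i * x) ≠ 0 := div_ne_zero (mul_ne_zero ha hq0) (mul_ne_zero hpi hx)
    have h := qInf_mul_zpow_neg hq0 hq hy m
    have e1 : a * q / (p i * x) * q ^ (-(m : ℤ)) = a * q / (p i * (x * q ^ m)) := by
      rw [zpow_neg, zpow_natCast]; field_simp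
    have e2 : q / (a * q / (p i * x)) = x * p i / a := by field_simp
    rw [e1, e2] at h
    rw [h, mul_assoc]
    congr 2
    field_simp
  have h2 := Finset.prod_congr (rfl : (Finset.univ : Finset (Fin 6)) = _) fun i _ => h1 i
  rw [Finset.prod_mul_distrib, Finset.prod_mul_distrib, Finset.prod_const, Finset.prod_pow,
    Finset.prod_div_distrib, Finset.prod_const] at h2
  simp only [Finset.card_univ, Fintype.card_fin] at h2
  have e3 : m * (m + 1) / 2 * 6 = 3 * m ^ 2 + 3 * m := by
    have := Nat.div_mul_cancel (even_iff_two_dvd.1 (Nat.even_mul_succ_self m))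
    rw [show m * (m + 1) / 2 * 6 = m * (m + 1) / 2 * 2 * 3 by ring, this]; ring
  rw [← pow_mul, e3] at h2
  have e4 : q ^ (3 * (m : ℤ) ^ 2) = q ^ (3 * m ^ 2) := by exact_mod_cast zpow_natCast q (3 * m ^ 2)
  have e5 : (x ^ 2 / a) ^ (3 * (m : ℤ)) = ((x ^ 2 / a) ^ 3) ^ m := by
    rw [show 3 * (m : ℤ) = ((3 * m : ℕ) : ℤ) by push_cast; ring, zpow_natCast, pow_mul]
  simp only [mul_assoc (qInf q (x * q / p _ * q ^ m))]
  rw [wpTerm, Finset.prod_mul_distrib, Finset.prod_mul_distrib, e4, e5]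
  simp only [zpow_natCast]
  have e6 : ∀ i, q * (x * q ^ m) / p i = x * q / p i * q ^ m := fun i => by ring
  simp only [e6]
  have e7 : (x * q ^ m)⁻¹ - x * q ^ m / a = x⁻¹ * (q ^ m)⁻¹ * (1 - x ^ 2 / a * q ^ (2 * m)) := by
    rw [pow_mul']; field_simp
  rw [pow_add, pow_mul q 3 m] at h2
  have h3 : (∏ i, qInf q (a * q / (p i * (x * q ^ m)))) * q ^ (3 * m ^ 2)
      = ((-(a * q / x)) ^ 6 / ∏ i, p i) ^ m * ((q ^ 3) ^ m)⁻¹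
        * ∏ i, ((∏ j ∈ Finset.range m, (1 - x * p i / a * q ^ j)) * qInf q (a * q / (p i * x))) := by
    have : (q ^ 3) ^ m ≠ 0 := pow_ne_zero _ (pow_ne_zero _ hq0)
    rw [mul_right_comm, eq_mul_inv_iff_mul_eq₀ this, mul_assoc]
    exact h2
  have e8 : ((-(a * q / x)) ^ 6 / ∏ i, p i) ^ m * ((q ^ 3) ^ m)⁻¹ * ((x ^ 2 / a) ^ 3) ^ m * (q ^ m)⁻¹
      = wpArg q a p ^ m := by
    rw [← inv_pow (q ^ 3) m, ← inv_pow q m, ← mul_pow, ← mul_pow, ← mul_pow, wpArg]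
    congr 1
    field_simp
  rw [e7, ← e8]
  linear_combination (x⁻¹ * (q ^ m)⁻¹ * (1 - x ^ 2 / a * q ^ (2 * m))
    * (∏ i, qInf q (x * q / p i * q ^ m)) * ((x ^ 2 / a) ^ 3) ^ m) * h3

theorem wpSum_reflect (hq0 : q ≠ 0) (ha : a ≠ 0) (hx : x ≠ 0) :
    wpSum q a p (a / x) = -wpSum q a p x := by
  rw [wpSum, wpSum, ← tsum_neg, ← (Equiv.neg ℤ).tsum_eq fun n => -wpTerm q a p n x]
  refine tsum_congr fun n => ?_
  rw [Equiv.neg_apply, wpTerm_neg hq0 ha hx, neg_neg]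

/-- Replacing `x` by `q x` is the shift `n ↦ n + 1`. The multiplier is what `3(n+1)² = 3n² + 6n + 3`
and the power of `x² / a` leave over. -/
theorem wpSum_q_mul (hq0 : q ≠ 0) (ha : a ≠ 0) (hx : x ≠ 0) :
    wpSum q a p (q * x) = (q ^ 3)⁻¹ * (a / x ^ 2) ^ 3 * wpSum q a p x := by
  rw [wpSum, wpSum, ← tsum_mul_left, ← (Equiv.addRight (1 : ℤ)).tsum_eq
    fun n => (q ^ 3)⁻¹ * (a / x ^ 2) ^ 3 * wpTerm q a p n x]
  refine tsum_congr fun n => ?_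
  have e1 : q * x * q ^ n = x * q ^ (n + 1) := by rw [zpow_add_one₀ hq0]; ring
  have hb : x ^ 2 / a ≠ 0 := div_ne_zero (pow_ne_zero _ hx) ha
  have e2 : q ^ (3 * n ^ 2) * ((q * x) ^ 2 / a) ^ (3 * n)
      = (q ^ 3)⁻¹ * (a / x ^ 2) ^ 3 * (q ^ (3 * (n + 1) ^ 2) * (x ^ 2 / a) ^ (3 * (n + 1))) := by
    rw [show (q * x) ^ 2 / a = q ^ 2 * (x ^ 2 / a) by ring, mul_zpow, ← zpow_natCast q 2, ← zpow_mul,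
      show (3 * (n + 1) ^ 2 : ℤ) = 3 * n ^ 2 + ((2 : ℕ) : ℤ) * (3 * n) + (3 : ℕ) by push_cast; ring,
      show (3 * (n + 1) : ℤ) = 3 * n + (3 : ℕ) by push_cast; ring, zpow_add₀ hq0, zpow_add₀ hq0,
      zpow_add₀ hb, zpow_natCast, zpow_natCast]
    have : q ^ 3 ≠ 0 := pow_ne_zero _ hq0
    generalize q ^ (3 * n ^ 2) = A
    generalize q ^ (((2 : ℕ) : ℤ) * (3 * n)) = B
    generalize (x ^ 2 / a) ^ (3 * n) = C
    field_simp
  rw [Equiv.coe_addRight, wpTerm, wpTerm, e1, mul_assoc, e2]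
  ring

/-- A locally bounded majorant of the coefficients of `wpTerm`. -/
def wpBound (q a : ℂ) (p : Fin 6 → ℂ) (x : ℂ) : ℝ :=
  ‖x⁻¹‖ * (1 + ‖x ^ 2 / a‖) * ∏ i, (Real.exp (‖x * q / p i‖ / (1 - ‖q‖))
    * Real.exp (‖x * p i / a‖ / (1 - ‖q‖)) * Real.exp (‖a * q / (p i * x)‖ / (1 - ‖q‖)))

theorem norm_pow_le_one (hq : ‖q‖ < 1) (m : ℕ) : ‖q ^ m‖ ≤ 1 := by
  rw [norm_pow]; exact pow_le_one₀ (norm_nonneg _) hq.le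

theorem norm_one_sub_mul_pow_le (hq : ‖q‖ < 1) (y : ℂ) (m : ℕ) : ‖1 - y * q ^ m‖ ≤ 1 + ‖y‖ := by
  refine (norm_sub_le _ _).trans ?_
  rw [norm_one, norm_mul]
  gcongr
  exact mul_le_of_le_one_right (norm_nonneg _) (norm_pow_le_one hq m)

theorem norm_qInf_mul_pow_le (hq : ‖q‖ < 1) (y : ℂ) (m : ℕ) :
    ‖qInf q (y * q ^ m)‖ ≤ Real.exp (‖y‖ / (1 - ‖q‖)) :=
  norm_qInf_le_of_le hq <| by
    rw [norm_mul]
    exact mul_le_of_le_one_right (norm_nonneg _) (norm_pow_le_one hq m)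

theorem norm_wpTerm_natCast_le (hq0 : q ≠ 0) (hq : ‖q‖ < 1) (ha : a ≠ 0) (hx : x ≠ 0)
    (hp : ∀ i, p i ≠ 0) (m : ℕ) : ‖wpTerm q a p m x‖ ≤ wpBound q a p x * ‖wpArg q a p‖ ^ m := by
  rw [wpTerm_natCast hq0 hq ha hx hp, wpBound, norm_mul, norm_mul, norm_mul, norm_pow,
    mul_right_comm _ (‖wpArg q a p‖ ^ m), norm_prod]
  gcongr with i
  · exact norm_one_sub_mul_pow_le hq _ _
  · rw [norm_mul, norm_mul]
    gcongr
    · exact norm_qInf_mul_pow_le hq _ _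
    · exact norm_prod_one_sub_le hq _ _
    · exact norm_qInf_le hq _

theorem wpBound_nonneg : 0 ≤ wpBound q a p x := by
  unfold wpBound; positivity

/-- Negative `n` are sent by `wpTerm_neg` to positive ones at base point `a / x`, whence the second
bound. -/
theorem norm_wpTerm_le (hq0 : q ≠ 0) (hq : ‖q‖ < 1) (ha : a ≠ 0) (hx : x ≠ 0)
    (hp : ∀ i, p i ≠ 0) (n : ℤ) :
    ‖wpTerm q a p n x‖ ≤ (wpBound q a p x + wpBound q a p (a / x)) * ‖wpArg q a p‖ ^ n.natAbs := by
  have h1 := wpBound_nonneg (q := q) (a := a) (p := p) (x := x)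
  have h2 := wpBound_nonneg (q := q) (a := a) (p := p) (x := a / x)
  obtain ⟨m, rfl | rfl⟩ := n.eq_nat_or_neg
  · rw [Int.natAbs_natCast]
    refine (norm_wpTerm_natCast_le hq0 hq ha hx hp m).trans ?_
    gcongr
    linarith
  · rw [Int.natAbs_neg, Int.natAbs_natCast, wpTerm_neg hq0 ha hx, norm_neg]
    refine (norm_wpTerm_natCast_le hq0 hq ha (div_ne_zero ha hx) hp m).trans ?_
    gcongr
    linarith

theorem summable_wpTerm (hq0 : q ≠ 0) (hq : ‖q‖ < 1) (ha : a ≠ 0) (hx : x ≠ 0)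
    (hp : ∀ i, p i ≠ 0) (hw : ‖wpArg q a p‖ < 1) : Summable fun n => wpTerm q a p n x :=
  ((summable_pow_natAbs (norm_nonneg _) hw).mul_left _).of_norm_bounded
    (norm_wpTerm_le hq0 hq ha hx hp)

theorem continuousOn_wpBound {X : Type*} [TopologicalSpace X] {U : Set X} {u : X → ℂ}
    {P : X → Fin 6 → ℂ} (hu : ContinuousOn u U) (hP : ∀ i, ContinuousOn (fun y => P y i) U)
    (hu0 : ∀ y ∈ U, u y ≠ 0) (hP0 : ∀ y ∈ U, ∀ i, P y i ≠ 0) :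
    ContinuousOn (fun y => wpBound q a (P y) (u y)) U := by
  unfold wpBound
  refine ((hu.inv₀ hu0).norm.mul (continuousOn_const.add ((hu.pow 2).div_const a).norm)).mul
    (continuousOn_finsetProd _ fun i _ => ?_)
  refine ContinuousOn.mul (ContinuousOn.mul ?_ ?_) ?_
  · exact ((((hu.mul continuousOn_const).div (hP i) fun y hy => hP0 y hy i).norm).div_const _).rexp
  · exact ((((hu.mul (hP i)).div_const a).norm).div_const _).rexp
  · exact (((continuousOn_const.div ((hP i).mul hu) fun y hy =>
      mul_ne_zero (hP0 y hy i) (hu0 y hy)).norm).div_const _).rexp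

theorem continuousOn_wpTerm (hq0 : q ≠ 0) (hq : ‖q‖ < 1) (hx : x ≠ 0)
    {X : Type*} [TopologicalSpace X] {U : Set X}
    {P : X → Fin 6 → ℂ} (hP : ∀ i, ContinuousOn (fun y => P y i) U)
    (hP0 : ∀ y ∈ U, ∀ i, P y i ≠ 0) (n : ℤ) :
    ContinuousOn (fun y => wpTerm q a (P y) n x) U := by
  unfold wpTerm
  have hc := continuous_qInf hq
  refine ((continuousOn_const.mul (continuousOn_finsetProd _ fun i _ => ?_)).mul
    continuousOn_const).mul continuousOn_const
  refine ContinuousOn.mul ?_ ?_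
  · exact hc.comp_continuousOn (continuousOn_const.div (hP i) fun y hy => hP0 y hy i)
  · exact hc.comp_continuousOn (continuousOn_const.div ((hP i).mul continuousOn_const) fun y hy =>
      mul_ne_zero (hP0 y hy i) (mul_ne_zero hx (zpow_ne_zero _ hq0)))

/-- The regularised sum depends continuously on the parameters. -/
theorem continuousOn_wpSum (hq0 : q ≠ 0) (hq : ‖q‖ < 1) (ha : a ≠ 0) (hx : x ≠ 0)
    {X : Type*} [TopologicalSpace X] {U : Set X} (hU : IsOpen U)
    {P : X → Fin 6 → ℂ} (hP : ∀ i, ContinuousOn (fun y => P y i) U)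
    (hP0 : ∀ y ∈ U, ∀ i, P y i ≠ 0) (hw : ∀ y ∈ U, ‖wpArg q a (P y)‖ < 1) :
    ContinuousOn (fun y => wpSum q a (P y) x) U := by
  refine continuousOn_tsum_geometric (fun ρ => summable_pow_natAbs) hU
    (fun n => continuousOn_wpTerm hq0 hq hx hP hP0 n)
    ((continuousOn_wpBound continuousOn_const hP (fun _ _ => hx) hP0).add
      (continuousOn_wpBound continuousOn_const hP (fun _ _ => div_ne_zero ha hx) hP0))
    ?_ (fun y _ => add_nonneg wpBound_nonneg wpBound_nonneg) (fun y _ => norm_nonneg _) hw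
    (fun n y hy => norm_wpTerm_le hq0 hq ha hx (hP0 y hy) n)
  exact (continuousOn_const.div (continuousOn_finsetProd _ fun i _ => hP i) fun y hy =>
    Finset.prod_ne_zero_iff.2 fun i _ => hP0 y hy i).norm

theorem differentiableOn_wpTerm (hq0 : q ≠ 0) (hq : ‖q‖ < 1) (ha : a ≠ 0)
    (hp : ∀ i, p i ≠ 0) (n : ℤ) : DifferentiableOn ℂ (wpTerm q a p n) {0}ᶜ := by
  intro x hx
  have hx : x ≠ 0 := hx
  have hqn : q ^ n ≠ 0 := zpow_ne_zero _ hq0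
  have hd := differentiable_qInf hq
  have hm : DifferentiableAt ℂ (fun x : ℂ => x * q ^ n) x := by fun_prop
  refine DifferentiableAt.differentiableWithinAt ?_
  unfold wpTerm
  refine (((hm.inv (mul_ne_zero hx hqn)).sub (hm.div_const a)).mul
    (DifferentiableAt.fun_finsetProd fun i _ => ?_)).mul_const _ |>.mul ?_
  · refine DifferentiableAt.mul ?_ ?_
    · exact (hd _).comp x ((hm.const_mul q).div_const _)
    · exact (hd _).comp x ((differentiableAt_const _).div (hm.const_mul _)
        (mul_ne_zero (hp i) (mul_ne_zero hx hqn)))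
  · exact ((differentiableAt_id.pow 2).div_const a).zpow
      (Or.inl (div_ne_zero (pow_ne_zero _ hx) ha))

theorem differentiableOn_wpSum (hq0 : q ≠ 0) (hq : ‖q‖ < 1) (ha : a ≠ 0)
    (hp : ∀ i, p i ≠ 0) (hw : ‖wpArg q a p‖ < 1) :
    DifferentiableOn ℂ (wpSum q a p) {0}ᶜ := by
  have h1 : ContinuousOn (fun x => wpBound q a p x) {0}ᶜ :=
    continuousOn_wpBound (P := fun _ => p) continuousOn_id (fun i => continuousOn_const)
      (fun _ h => h) fun _ _ => hp
  have h2 : ContinuousOn (fun x => wpBound q a p (a / x)) {0}ᶜ :=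
    continuousOn_wpBound (P := fun _ => p) (continuousOn_const.div continuousOn_id fun _ h => h)
      (fun i => continuousOn_const) (fun _ h => div_ne_zero ha h) fun _ _ => hp
  exact differentiableOn_tsum_geometric (fun ρ => summable_pow_natAbs) isOpen_compl_singleton
    (fun n => differentiableOn_wpTerm hq0 hq ha hp n)
    (h1.add h2) (r := fun _ => ‖wpArg q a p‖) continuousOn_const
    (fun y _ => add_nonneg wpBound_nonneg wpBound_nonneg)
    (fun y _ => norm_nonneg _) (fun _ _ => hw)
    (fun n y hy => norm_wpTerm_le hq0 hq ha hy hp n)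

end WellPoised

/-! ### Odd theta functions of degree six and the three-term relation -/

section ThreeTerm

variable {q a z x : ℂ} {p : Fin 6 → ℂ}

theorem deriv_mul_ne_zero {A g : ℂ → ℂ} (hA : DifferentiableAt ℂ A x)
    (hg : DifferentiableAt ℂ g x) (h0 : A x = 0) (h1 : deriv A x ≠ 0) (h2 : g x ≠ 0) :
    deriv (fun y => A y * g y) x ≠ 0 := by
  have h := (hA.hasDerivAt.mul hg.hasDerivAt).deriv
  rw [h0, zero_mul, add_zero] at h
  exact fun h3 => mul_ne_zero h1 h2 (h.symm.trans h3)

theorem deriv_thetaProd_comp_ne_zero (hq0 : q ≠ 0) (hq : ‖q‖ < 1) {u : ℂ → ℂ} {u' : ℂ}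
    (hu : HasDerivAt u u' x) (hu' : u' ≠ 0) (hux : u x ≠ 0) (h0 : thetaProd q (u x) = 0) :
    deriv (fun y => thetaProd q (u y)) x ≠ 0 := by
  have h := ((differentiableAt_thetaProd hq hux).hasDerivAt.comp x hu).deriv
  exact fun h3 => mul_ne_zero (deriv_thetaProd_ne_zero hq0 hq hux h0) hu' (h.symm.trans h3)

theorem differentiableAt_thetaProd_comp (hq : ‖q‖ < 1) {u : ℂ → ℂ} (hu : DifferentiableAt ℂ u x)
    (hux : u x ≠ 0) : DifferentiableAt ℂ (fun y => thetaProd q (u y)) x :=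
  (differentiableAt_thetaProd hq hux).comp x hu

/-- An odd theta function of degree six on `ℂˣ`, with respect to `x ↦ a / x`. -/
structure IsOddTheta (q a : ℂ) (E : ℂ → ℂ) : Prop where
  differentiableOn : DifferentiableOn ℂ E {0}ᶜ
  q_mul : ∀ x, x ≠ 0 → E (q * x) = (q ^ 3)⁻¹ * (a / x ^ 2) ^ 3 * E x
  reflect : ∀ x, x ≠ 0 → E (a / x) = -E x

theorem isOddTheta_wpSum (hq0 : q ≠ 0) (hq : ‖q‖ < 1) (ha : a ≠ 0)
    (hp : ∀ i, p i ≠ 0) (hw : ‖wpArg q a p‖ < 1) : IsOddTheta q a (wpSum q a p) where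
  differentiableOn := differentiableOn_wpSum hq0 hq ha hp hw
  q_mul _ hx := wpSum_q_mul hq0 ha hx
  reflect _ hx := wpSum_reflect hq0 ha hx

/-- Interpolation functions: `x⁻¹ θ(x²/a)` carries the forced zeros, and the even factor of degree
two vanishes at `z` and `a / z`. The parameters `z` and `a` are the two used. -/
theorem isOddTheta_basis (hq0 : q ≠ 0) (hq : ‖q‖ < 1) (ha : a ≠ 0) (hz : z ≠ 0) :
    IsOddTheta q a
      (fun x => x⁻¹ * thetaProd q (x ^ 2 / a) * (thetaProd q (x * z / a) * thetaProd q (z / x))) where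
  differentiableOn := by
    intro x hx
    have hx : x ≠ 0 := hx
    refine DifferentiableAt.differentiableWithinAt ?_
    refine ((differentiableAt_inv hx).mul ?_).mul (.mul ?_ ?_)
    · exact differentiableAt_thetaProd_comp hq (by fun_prop) (div_ne_zero (pow_ne_zero _ hx) ha)
    · exact differentiableAt_thetaProd_comp hq (by fun_prop) (div_ne_zero (mul_ne_zero hx hz) ha)
    · exact differentiableAt_thetaProd_comp hq ((differentiableAt_const _).div differentiableAt_id hx)
        (div_ne_zero hz hx)
  q_mul x hx := by
    have hb : x ^ 2 / a ≠ 0 := div_ne_zero (pow_ne_zero _ hx) ha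
    have e1 : (q * x) ^ 2 / a = q * (q * (x ^ 2 / a)) := by ring
    have e2 : q * x * z / a = q * (x * z / a) := by ring
    have e3 : z / (q * x) = z / x / q := by rw [div_div, mul_comm]
    simp only [e1, e2, e3]
    rw [thetaProd_q_mul hq0 hq (mul_ne_zero hq0 hb), thetaProd_q_mul hq0 hq hb,
      thetaProd_q_mul hq0 hq (div_ne_zero (mul_ne_zero hx hz) ha),
      thetaProd_div_q hq0 hq (div_ne_zero hz hx)]
    field_simp
  reflect x hx := by
    have hb : x ^ 2 / a ≠ 0 := div_ne_zero (pow_ne_zero _ hx) ha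
    have e1 : (a / x) ^ 2 / a = (x ^ 2 / a)⁻¹ := by field_simp
    have e2 : a / x * z / a = z / x := by field_simp
    have e3 : z / (a / x) = x * z / a := by field_simp
    simp only [e1, e2, e3]
    rw [thetaProd_inv hq0 hq hb]
    field_simp

theorem IsOddTheta.combination {E F : ℂ → ℂ} (hE : IsOddTheta q a E) (hF : IsOddTheta q a F)
    (c : ℂ) : IsOddTheta q a (fun x => E x - c * F x) where
  differentiableOn := hE.differentiableOn.sub (hF.differentiableOn.const_mul c)
  q_mul x hx := by rw [hE.q_mul x hx, hF.q_mul x hx]; ring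
  reflect x hx := by rw [hE.reflect x hx, hF.reflect x hx]; ring

theorem IsOddTheta.zpow_mul_eq_zero {E : ℂ → ℂ} (hE : IsOddTheta q a E) (hq0 : q ≠ 0) (ha : a ≠ 0)
    (hx : x ≠ 0) (h : E x = 0) (m : ℤ) : E (q ^ m * x) = 0 := by
  refine zpow_induction (P := fun u => E (u * x) = 0) hq0 (by simpa using h) (fun u hu => ?_) m
  rw [mul_assoc, hE.q_mul _ (mul_ne_zero hu hx)]
  simp [hq0, ha, hu, hx]

/-- Such an `x` is a power of `q` times a fixed point `y` of `y ↦ a / y` (`m` even) or of `y ↦ q a /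
y` (`m` odd). In the odd case the multiplier at `a / y` equals `1`, so in both cases oddness reads
`E y = -E y`. -/
theorem IsOddTheta.eq_zero_of_sq {E : ℂ → ℂ} (hE : IsOddTheta q a E) (hq0 : q ≠ 0) (ha : a ≠ 0)
    (hx : x ≠ 0) {m : ℤ} (h : x ^ 2 / a = q ^ m) : E x = 0 := by
  rw [div_eq_iff ha] at h
  obtain ⟨j, rfl | rfl⟩ := m.even_or_odd'
  · have hqj : q ^ j ≠ 0 := zpow_ne_zero _ hq0
    have hy : x / q ^ j ≠ 0 := div_ne_zero hx hqj
    have e : a / (x / q ^ j) = x / q ^ j := by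
      rw [two_mul, zpow_add₀ hq0] at h
      field_simp
      linear_combination -h
    have h1 := hE.reflect _ hy
    rw [e] at h1
    have := hE.zpow_mul_eq_zero hq0 ha hy (self_eq_neg.1 h1) j
    rwa [mul_div_cancel₀ _ hqj] at this
  · have hqj : q ^ j ≠ 0 := zpow_ne_zero _ hq0
    have hy : x / q ^ j ≠ 0 := div_ne_zero hx hqj
    rw [zpow_add_one₀ hq0, two_mul, zpow_add₀ hq0] at h
    have e : q * (a / (x / q ^ j)) = x / q ^ j := by
      field_simp
      linear_combination -h
    have h1 := hE.reflect _ hy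
    have h2 := hE.q_mul _ (div_ne_zero ha hy)
    have e2 : (q ^ 3)⁻¹ * (a / (a / (x / q ^ j)) ^ 2) ^ 3 = 1 := by
      have : a / (a / (x / q ^ j)) ^ 2 = q := by
        field_simp
        linear_combination h
      rw [this, inv_mul_cancel₀ (pow_ne_zero _ hq0)]
    rw [e, e2, one_mul, h1] at h2
    have := hE.zpow_mul_eq_zero hq0 ha hy (self_eq_neg.1 h2) j
    rwa [mul_div_cancel₀ _ hqj] at this

/-- An odd theta function of degree six is determined by its values at `a` and `z`. -/
theorem IsOddTheta.eq_zero {E : ℂ → ℂ} (hE : IsOddTheta q a E) (hq0 : q ≠ 0) (hq : ‖q‖ < 1)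
    (ha0 : a ≠ 0) (hz0 : z ≠ 0) (ha : ∀ m : ℤ, a ≠ q ^ m) (hza : ∀ m : ℤ, z ^ 2 / a ≠ q ^ m)
    (hz : ∀ m : ℤ, z ≠ q ^ m ∧ z / a ≠ q ^ m) (hEa : E a = 0) (hEz : E z = 0) (hx : x ≠ 0) :
    E x = 0 := by
  have hsq : ∀ y : ℂ, y ≠ 0 → y ^ 2 / a ≠ 0 := fun y hy => div_ne_zero (pow_ne_zero _ hy) ha0
  have d0 : ∀ y : ℂ, y ≠ 0 → DifferentiableAt ℂ (fun y : ℂ => (y ^ 2)⁻¹) y := fun y hy =>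
    DifferentiableAt.inv (by fun_prop) (pow_ne_zero _ hy)
  have d1 : ∀ y : ℂ, y ≠ 0 → DifferentiableAt ℂ (thetaProd q) y := fun y hy =>
    differentiableAt_thetaProd hq hy
  have d2 : ∀ y : ℂ, y ≠ 0 → DifferentiableAt ℂ (fun y => thetaProd q (y / a)) y := fun y hy =>
    differentiableAt_thetaProd_comp hq (by fun_prop) (div_ne_zero hy ha0)
  have d3 : ∀ y : ℂ, y ≠ 0 → DifferentiableAt ℂ (fun y => thetaProd q (y ^ 2 / a)) y := fun y hy =>
    differentiableAt_thetaProd_comp hq (by fun_prop) (hsq y hy)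
  -- The comparison function `y⁻² θ(y) θ(y/a) θ(y²/a)` has the multiplier of `E`. Its three families
  -- of zeros are disjoint, hence simple, because `a` is not a power of `q`. `E` vanishes on `a q^ℤ`
  -- by assumption, on `q^ℤ` by reflecting `a` to `1`, and on `y² ∈ a q^ℤ` by oddness.
  have key : ∀ y : ℂ, y ≠ 0 →
      (y ^ 2)⁻¹ * (thetaProd q y * (thetaProd q (y / a) * thetaProd q (y ^ 2 / a))) = 0 →
      E y = 0 ∧ deriv (fun y => (y ^ 2)⁻¹ * (thetaProd q y * (thetaProd q (y / a) *
        thetaProd q (y ^ 2 / a)))) y ≠ 0 := by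
    intro y hy h0
    have hy2 : (y ^ 2)⁻¹ ≠ 0 := inv_ne_zero (pow_ne_zero _ hy)
    rw [mul_eq_zero, mul_eq_zero, mul_eq_zero] at h0
    rcases h0 with h0 | h0 | h0 | h0
    · exact absurd h0 hy2
    · obtain ⟨m, rfl⟩ := exists_of_thetaProd_eq_zero hq0 hq hy h0
      constructor
      · have h1 := hE.reflect a ha0
        rw [div_self ha0, hEa, neg_zero] at h1
        simpa using hE.zpow_mul_eq_zero hq0 ha0 one_ne_zero h1 m
      · have n2 : thetaProd q (q ^ m / a) ≠ 0 := by
          refine thetaProd_ne_zero hq0 hq (div_ne_zero hy ha0) fun k hk => ha (m - k) ?_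
          rw [zpow_sub₀ hq0, ← hk, div_div_cancel₀ hy]
        have n3 : thetaProd q ((q ^ m) ^ 2 / a) ≠ 0 := by
          refine thetaProd_ne_zero hq0 hq (hsq _ hy) fun k hk => ha (m + m - k) ?_
          rw [zpow_sub₀ hq0, zpow_add₀ hq0, ← sq, ← hk, div_div_cancel₀ (pow_ne_zero _ hy)]
        have := deriv_mul_ne_zero (d1 _ hy) ((d0 _ hy).mul ((d2 _ hy).mul (d3 _ hy))) h0
          (deriv_thetaProd_ne_zero hq0 hq hy h0) (mul_ne_zero hy2 (mul_ne_zero n2 n3))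
        refine fun h => this (Eq.trans (congrArg (fun f => deriv f (q ^ m)) ?_) h)
        funext w
        simp only [Pi.mul_apply]
        ring
    · obtain ⟨m, hm⟩ := exists_of_thetaProd_eq_zero hq0 hq (div_ne_zero hy ha0) h0
      have hya : y = q ^ m * a := (div_eq_iff ha0).1 hm
      have hqm : q ^ m ≠ 0 := zpow_ne_zero _ hq0
      constructor
      · rw [hya]; exact hE.zpow_mul_eq_zero hq0 ha0 ha0 hEa m
      · have n1 : thetaProd q y ≠ 0 := by
          refine thetaProd_ne_zero hq0 hq hy fun k hk => ha (k - m) ?_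
          rw [zpow_sub₀ hq0, ← hk, hya, mul_div_cancel_left₀ _ hqm]
        have n3 : thetaProd q (y ^ 2 / a) ≠ 0 := by
          refine thetaProd_ne_zero hq0 hq (hsq _ hy) fun k hk => ha (k - (m + m)) ?_
          rw [zpow_sub₀ hq0, zpow_add₀ hq0, ← hk, hya]
          field_simp
        have := deriv_mul_ne_zero (d2 _ hy) ((d0 _ hy).mul ((d1 _ hy).mul (d3 _ hy))) h0
          (deriv_thetaProd_comp_ne_zero hq0 hq ((hasDerivAt_id y).div_const a)
            (div_ne_zero one_ne_zero ha0) (div_ne_zero hy ha0) h0)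
          (mul_ne_zero hy2 (mul_ne_zero n1 n3))
        refine fun h => this (Eq.trans (congrArg (fun f => deriv f y) ?_) h)
        funext w
        simp only [Pi.mul_apply]
        ring
    · obtain ⟨m, hm⟩ := exists_of_thetaProd_eq_zero hq0 hq (hsq _ hy) h0
      refine ⟨hE.eq_zero_of_sq hq0 ha0 hy hm, ?_⟩
      have n1 : thetaProd q y ≠ 0 := by
        refine thetaProd_ne_zero hq0 hq hy fun k hk => ha (k + k - m) ?_
        rw [zpow_sub₀ hq0, zpow_add₀ hq0, ← hk, ← hm]
        field_simp
      have n2 : thetaProd q (y / a) ≠ 0 := by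
        refine thetaProd_ne_zero hq0 hq (div_ne_zero hy ha0) fun k hk => ha (m - (k + k)) ?_
        rw [zpow_sub₀ hq0, zpow_add₀ hq0, ← hk, ← hm]
        field_simp
      have := deriv_mul_ne_zero (d3 _ hy) ((d0 _ hy).mul ((d1 _ hy).mul (d2 _ hy))) h0
        (deriv_thetaProd_comp_ne_zero hq0 hq ((hasDerivAt_pow 2 y).div_const a)
          (div_ne_zero (by simpa using hy) ha0) (hsq _ hy) h0)
        (mul_ne_zero hy2 (mul_ne_zero n1 n2))
      refine fun h => this (Eq.trans (congrArg (fun f => deriv f y) ?_) h)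
      funext w
      simp only [Pi.mul_apply]
      ring
  obtain ⟨K, hK⟩ := exists_eq_const_mul hq0 hq hE.differentiableOn
    (fun y hy => ((d0 y hy).mul ((d1 y hy).mul ((d2 y hy).mul (d3 y hy)))).differentiableWithinAt)
    key (m := fun y => (q ^ 3)⁻¹ * (a / y ^ 2) ^ 3)
    (fun y hy => mul_ne_zero (inv_ne_zero (pow_ne_zero _ hq0))
      (pow_ne_zero _ (div_ne_zero ha0 (pow_ne_zero _ hy)))) hE.q_mul
    (fun y hy => by
      have e1 : (q * y) ^ 2 / a = q * (q * (y ^ 2 / a)) := by ring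
      have e2 : q * y / a = q * (y / a) := by ring
      simp only [Pi.mul_apply, e1, e2]
      rw [thetaProd_q_mul hq0 hq (mul_ne_zero hq0 (hsq y hy)), thetaProd_q_mul hq0 hq (hsq y hy),
        thetaProd_q_mul hq0 hq (div_ne_zero hy ha0), thetaProd_q_mul hq0 hq hy]
      field_simp)
  -- The comparison function does not vanish at `z`, while `E` does.
  have hK0 : K = 0 := by
    have h := hK z hz0
    rw [hEz] at h
    refine (mul_eq_zero.1 h.symm).resolve_right (mul_ne_zero (inv_ne_zero (pow_ne_zero _ hz0))
      (mul_ne_zero ?_ (mul_ne_zero ?_ ?_)))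
    · exact thetaProd_ne_zero hq0 hq hz0 fun m => (hz m).1
    · exact thetaProd_ne_zero hq0 hq (div_ne_zero hz0 ha0) fun m => (hz m).2
    · exact thetaProd_ne_zero hq0 hq (hsq z hz0) hza
  rw [hK x hx, hK0, zero_mul]

/-- The connection formula between the values of an odd theta function of degree six. -/
theorem IsOddTheta.connection {E : ℂ → ℂ} (hE : IsOddTheta q a E) (hq0 : q ≠ 0) (hq : ‖q‖ < 1)
    (ha0 : a ≠ 0) (hz0 : z ≠ 0) (ha : ∀ m : ℤ, a ≠ q ^ m) (hza : ∀ m : ℤ, z ^ 2 / a ≠ q ^ m)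
    (hz : ∀ m : ℤ, z ≠ q ^ m ∧ z / a ≠ q ^ m) (hx : x ≠ 0) :
    x * E x = thetaProd q (x ^ 2 / a) *
      (a * E a / thetaProd q a * (thetaProd q (x * z / a) * thetaProd q (z / x)
          / (thetaProd q (z / a) * thetaProd q z))
        + z * E z / thetaProd q (z ^ 2 / a) * (thetaProd q (a / x) * thetaProd q x
          / (thetaProd q (a / z) * thetaProd q z))) := by
  have n1 : thetaProd q a ≠ 0 := thetaProd_ne_zero hq0 hq ha0 ha
  have n2 : thetaProd q z ≠ 0 := thetaProd_ne_zero hq0 hq hz0 fun m => (hz m).1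
  have n3 : thetaProd q (z / a) ≠ 0 :=
    thetaProd_ne_zero hq0 hq (div_ne_zero hz0 ha0) fun m => (hz m).2
  have n4 : thetaProd q (z ^ 2 / a) ≠ 0 :=
    thetaProd_ne_zero hq0 hq (div_ne_zero (pow_ne_zero _ hz0) ha0) hza
  have n5 : thetaProd q (a / z) ≠ 0 := by
    rw [← inv_div, thetaProd_inv hq0 hq (div_ne_zero hz0 ha0)]
    exact mul_ne_zero (neg_ne_zero.2 (inv_ne_zero (div_ne_zero hz0 ha0))) n3
  -- The basis function with parameter `a` vanishes at `a` and the one with parameter `z` vanishes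
  -- at `z`, so each coefficient is read off from a single value of `E`.
  set α := a * E a / thetaProd q a / (thetaProd q (z / a) * thetaProd q z) with hα
  set β := z * E z / thetaProd q (z ^ 2 / a) / (thetaProd q (a / z) * thetaProd q z) with hβ
  have hD := (hE.combination (isOddTheta_basis hq0 hq ha0 hz0) α).combination
    (isOddTheta_basis hq0 hq ha0 ha0) β
  have h0 := hD.eq_zero hq0 hq ha0 hz0 ha hza hz ?_ ?_ hx
  · have e : x * a / a = x := mul_div_cancel_right₀ _ ha0
    simp only [e] at h0
    have : x * E x - thetaProd q (x ^ 2 / a) * (α * (thetaProd q (x * z / a) * thetaProd q (z / x))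
        + β * (thetaProd q x * thetaProd q (a / x))) = 0 := by
      rw [← mul_zero x, ← h0]
      field_simp
      ring
    rw [sub_eq_zero.1 this, hα, hβ]
    ring
  · have e1 : a ^ 2 / a = a := by field_simp
    have e2 : a * z / a = z := by field_simp
    simp only [e1, e2, div_self ha0, thetaProd_one hq, hα]
    field_simp
    ring
  · have e1 : z * a / a = z := by field_simp
    simp only [e1, div_self hz0, thetaProd_one hq, hβ]
    field_simp
    ring

end ThreeTerm

/-! ### From the bilateral series to the regularised sum -/

section Identification

variable {q a x : ℂ} {p : Fin 6 → ℂ}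

theorem qPoch_natCast (q x : ℂ) (n : ℕ) :
    qPoch q x n = ∏ j ∈ Finset.range n, (1 - x * q ^ j) := rfl

theorem qPoch_neg_succ (q x : ℂ) (n : ℕ) :
    qPoch q x (-((n + 1 : ℕ) : ℤ)) = (∏ j ∈ Finset.range (n + 1), (1 - x * (q ^ (j + 1))⁻¹))⁻¹ := rfl

theorem prod_mul_qInf_neg (hq0 : q ≠ 0) (hq : ‖q‖ < 1) (y : ℂ) (n : ℕ) :
    (∏ j ∈ Finset.range n, (1 - y * (q ^ (j + 1))⁻¹)) * qInf q y = qInf q (q ^ (-(n : ℤ)) * y) := by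
  induction n with
  | zero => simp
  | succ n ih =>
    rw [qInf_eq_mul hq (q ^ (-((n + 1 : ℕ) : ℤ)) * y), Finset.prod_range_succ]
    have e : q * (q ^ (-((n + 1 : ℕ) : ℤ)) * y) = q ^ (-(n : ℤ)) * y := by
      rw [show -(n : ℤ) = -((n + 1 : ℕ) : ℤ) + 1 by push_cast; ring, zpow_add_one₀ hq0]; ring
    rw [e, ← ih, zpow_neg, zpow_natCast]
    ring

/-- Stated for the inverse, so that `(q^n y;q)_∞` may vanish: for `n < 0` a pole of `(y;q)_n` is
encoded as `0`, and its inverse `0` is the correct value. -/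
theorem inv_qPoch (hq0 : q ≠ 0) (hq : ‖q‖ < 1) {y : ℂ} (hy : qInf q y ≠ 0) (n : ℤ) :
    (qPoch q y n)⁻¹ = qInf q (q ^ n * y) / qInf q y := by
  obtain ⟨m, rfl | rfl⟩ := n.eq_nat_or_neg
  · have h := prod_mul_qInf hq y m
    rw [qPoch_natCast, zpow_natCast, ← h]
    rw [← h] at hy
    exact (div_mul_cancel_right₀ (right_ne_zero_of_mul hy) _).symm
  · cases m with
    | zero => simp [qPoch, hy]
    | succ m =>
      rw [qPoch_neg_succ, inv_inv, ← prod_mul_qInf_neg hq0 hq, mul_div_cancel_right₀ _ hy]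

/-- Counterpart of `inv_qPoch` for upper parameters. Nonvanishing of `(q/u;q)_∞` excludes exactly `u
= q^j` with `j ≥ 1`, the poles of `(u;q)_n` for negative `n`. -/
theorem qPoch_mul_qInf (hq0 : q ≠ 0) (hq : ‖q‖ < 1) {u : ℂ} (hu0 : u ≠ 0)
    (hu : qInf q (q / u) ≠ 0) (n : ℤ) :
    qPoch q u n * qInf q (q / u)
      = qInf q (q / (u * q ^ n)) * (-u) ^ n * q ^ (n * (n - 1) / 2) := by
  obtain ⟨m, rfl | rfl⟩ := n.eq_nat_or_neg
  · induction m with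
    | zero => simp [qPoch]
    | succ m ih =>
      have hm : q ^ (m : ℤ) ≠ 0 := zpow_ne_zero _ hq0
      have h1 : qPoch q u ((m + 1 : ℕ) : ℤ) = qPoch q u m * (1 - u * q ^ (m : ℤ)) := by
        rw [qPoch_natCast, qPoch_natCast, Finset.prod_range_succ, zpow_natCast]
      have h2 := qInf_eq_mul hq (q / (u * q ^ (m + 1 : ℤ)))
      have h3 : q * (q / (u * q ^ (m + 1 : ℤ))) = q / (u * q ^ (m : ℤ)) := by
        rw [zpow_add_one₀ hq0]; field_simp
      rw [h3] at h2
      push_cast at h1 ⊢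
      rw [h1, h2, thetaExponent_add_one, zpow_add₀ hq0 _ (m : ℤ), zpow_add_one₀ (neg_ne_zero.2 hu0),
        mul_right_comm, ih, zpow_add_one₀ hq0]
      field_simp
      ring
  · induction m with
    | zero => simp [qPoch]
    | succ m ih =>
      have hm : q ^ (m : ℤ) ≠ 0 := zpow_ne_zero _ hq0
      have hm1 : q ^ (m + 1) ≠ 0 := pow_ne_zero _ hq0
      have hne : 1 - u * (q ^ (m + 1))⁻¹ ≠ 0 := by
        intro h
        refine hu (qInf_eq_zero hq (n := m) ?_)
        rw [div_mul_eq_mul_div, ← pow_succ', div_eq_one_iff_eq hu0]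
        field_simp at h
        linear_combination h
      have h1 : qPoch q u (-((m + 1 : ℕ) : ℤ)) = qPoch q u (-(m : ℤ)) * (1 - u * (q ^ (m + 1))⁻¹)⁻¹ := by
        rw [qPoch_neg_succ, Finset.prod_range_succ, mul_inv]
        cases m with
        | zero => simp [qPoch]
        | succ m => rw [qPoch_neg_succ]
      have h2 := qInf_eq_mul hq (q / (u * q ^ (-(m : ℤ))))
      have h3 : q * (q / (u * q ^ (-(m : ℤ)))) = q / (u * q ^ (-((m + 1 : ℕ) : ℤ))) := by
        rw [zpow_neg, zpow_neg, zpow_natCast, zpow_natCast, pow_succ]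
        field_simp
      rw [h3] at h2
      have e : -((m + 1 : ℕ) : ℤ) = -(m : ℤ) - 1 := by push_cast; ring
      have h4 := thetaExponent_add_one (-((m + 1 : ℕ) : ℤ))
      rw [show -((m + 1 : ℕ) : ℤ) + 1 = -(m : ℤ) by push_cast; ring] at h4
      have hk : q ^ (-((m + 1 : ℕ) : ℤ)) = (q ^ (m + 1))⁻¹ := by rw [zpow_neg, zpow_natCast]
      have h5 : 1 - q / (u * q ^ (-(m : ℤ))) = -(q ^ (m + 1)) * u⁻¹ * (1 - u * (q ^ (m + 1))⁻¹) := by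
        rw [zpow_neg, zpow_natCast]; field_simp; ring
      rw [h4, zpow_add₀ hq0, h2, h5, hk] at ih
      have h6 : (-u) ^ (-((m + 1 : ℕ) : ℤ)) = (-u) ^ (-(m : ℤ)) * (-u)⁻¹ := by
        rw [e, zpow_sub_one₀ (neg_ne_zero.2 hu0)]
      have hne' : q ^ (m + 1) - u ≠ 0 := by
        intro h
        exact hne (by rw [← sub_eq_zero.1 h, mul_inv_cancel₀ hm1, sub_self])
      rw [h1, h6, mul_right_comm, ih, hk]
      field_simp

theorem qPoch_q_mul_div (hq0 : q ≠ 0) (hq : ‖q‖ < 1) {y : ℂ} (n : ℤ) (hy : qInf q y ≠ 0)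
    (hn : qInf q (q ^ n * y) ≠ 0) :
    qPoch q (q * y) n / qPoch q y n = (1 - y * q ^ n) / (1 - y) := by
  have h1 := qInf_eq_mul hq y
  have h2 := qInf_eq_mul hq (q ^ n * y)
  have e : q * (q ^ n * y) = q ^ n * (q * y) := by ring
  rw [e] at h2
  rw [h1] at hy
  rw [h2] at hn
  have a1 := left_ne_zero_of_mul hy
  have a2 := right_ne_zero_of_mul hy
  have b1 := left_ne_zero_of_mul hn
  have b2 := right_ne_zero_of_mul hn
  rw [qPoch_eq_div hq0 hq (q * y) n a2 b2, qPoch_eq_div hq0 hq y n (by rwa [h1]) (by rwa [h2]),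
    h1, h2]
  rw [mul_comm (q ^ n) y] at b1 ⊢
  generalize qInf q (q ^ n * (q * y)) = Z at *
  generalize qInf q (q * y) = Y at *
  field_simp

/-- The very-well-poised factor. -/
theorem qPoch_veryWellPoised (hq0 : q ≠ 0) (hq : ‖q‖ < 1) {A s : ℂ} (hs : s ^ 2 = A) (hs0 : s ≠ 0)
    (n : ℤ) (hA : ∀ k : ℕ, A * q ^ (2 * k) ≠ 1) (hAn : ∀ k : ℕ, A * (q ^ n * q ^ k) ^ 2 ≠ 1) :
    qPoch q (q * s) n * qPoch q (-(q * s)) n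
        / (qPoch q (A * q / (q * s)) n * qPoch q (A * q / -(q * s)) n)
      = (1 - A * (q ^ n) ^ 2) / (1 - A) := by
  have e1 : A * q / (q * s) = s := by rw [← hs]; field_simp
  have e2 : A * q / -(q * s) = -s := by rw [← hs]; field_simp
  -- The ratio telescopes, and the cases `t = ± s` multiply to a ratio depending only on `s² = A`.
  have key : ∀ t : ℂ, t ^ 2 = A → qPoch q (q * t) n / qPoch q t n = (1 - t * q ^ n) / (1 - t) := by
    intro t ht
    refine qPoch_q_mul_div hq0 hq n (qInf_ne_zero hq fun k hk => hA k ?_)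
      (qInf_ne_zero hq fun k hk => hAn k ?_)
    · rw [← ht, pow_mul', ← mul_pow, hk, one_pow]
    · rw [← ht, ← mul_pow, ← one_pow (M := ℂ) 2, ← hk]; ring
  rw [e1, e2, mul_div_mul_comm, key s hs, ← mul_neg, key (-s) (by rw [neg_sq, hs]), div_mul_div_comm,
    ← hs]
  congr 1 <;> ring

theorem vwpPsiTerm_eq (hq0 : q ≠ 0) (hq : ‖q‖ < 1) {A : ℂ} (hA0 : A ≠ 0) (hA : ∀ m : ℤ, A ≠ q ^ m)
    (u : Fin 6 → ℂ) (w : ℂ) (n : ℤ) :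
    vwpPsiTerm q A [u 0, u 1, u 2, u 3, u 4, u 5] w n
      = (1 - A * (q ^ n) ^ 2) / (1 - A) * (∏ i, (qPoch q (u i) n * (qPoch q (A * q / u i) n)⁻¹))
        * w ^ n := by
  have hs : (A ^ (1 / 2 : ℂ)) ^ 2 = A := by
    rw [one_div]; exact Complex.cpow_nat_inv_pow A two_ne_zero
  have hs0 : A ^ (1 / 2 : ℂ) ≠ 0 := fun h => hA0 (by rw [← hs, h]; simp)
  have h := qPoch_veryWellPoised hq0 hq hs hs0 n
    (fun k hk => hA (-((2 * k : ℕ) : ℤ)) (by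
      rw [zpow_neg, zpow_natCast]; exact eq_inv_of_mul_eq_one_left hk))
    (fun k hk => hA (-((n + k) * (2 : ℕ))) (by
      rw [zpow_neg, zpow_mul, zpow_natCast, zpow_add₀ hq0, zpow_natCast]
      exact eq_inv_of_mul_eq_one_left hk))
  rw [← h, Fin.prod_univ_six]
  simp only [vwpPsiTerm, psiTerm, vwpUpper, vwpLower, qPochL, List.map_cons, List.map_nil,
    List.prod_cons, List.prod_nil, div_eq_mul_inv, mul_inv]
  ring

/-- The bilateral series as a normalised `wpSum`. -/
theorem vwpPsiTerm_eq_wpTerm (hq0 : q ≠ 0) (hq : ‖q‖ < 1) (ha : a ≠ 0) (hx : x ≠ 0)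
    (hp : ∀ i, p i ≠ 0) (hA : ∀ m : ℤ, x ^ 2 / a ≠ q ^ m)
    (h1 : ∀ i, qInf q (x * q / p i) ≠ 0) (h2 : ∀ i, qInf q (a * q / (p i * x)) ≠ 0) (n : ℤ) :
    vwpPsiTerm q (x ^ 2 / a)
      [p 0 * x / a, p 1 * x / a, p 2 * x / a, p 3 * x / a, p 4 * x / a, p 5 * x / a]
      (wpArg q a p) n
      = x / ((1 - x ^ 2 / a) * ∏ i, (qInf q (x * q / p i) * qInf q (a * q / (p i * x))))
        * wpTerm q a p n x := by
  have hA1 : 1 - x ^ 2 / a ≠ 0 := fun h => hA 0 (by rw [zpow_zero]; linear_combination -h)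
  have hP : ∏ i, p i ≠ 0 := Finset.prod_ne_zero_iff.2 fun i _ => hp i
  have hD : ∏ i, (qInf q (x * q / p i) * qInf q (a * q / (p i * x))) ≠ 0 :=
    Finset.prod_ne_zero_iff.2 fun i _ => mul_ne_zero (h1 i) (h2 i)
  have hqn : q ^ n ≠ 0 := zpow_ne_zero _ hq0
  rw [vwpPsiTerm_eq hq0 hq (div_ne_zero (pow_ne_zero _ hx) ha) hA (fun i => p i * x / a)]
  have hi : ∀ i, qPoch q (p i * x / a) n * (qPoch q (x ^ 2 / a * q / (p i * x / a)) n)⁻¹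
      * (qInf q (x * q / p i) * qInf q (a * q / (p i * x)))
      = (qInf q (q * (x * q ^ n) / p i) * qInf q (a * q / (p i * (x * q ^ n))))
        * (-(p i * x / a)) ^ n * q ^ (n * (n - 1) / 2) := by
    intro i
    have hpi := hp i
    have e1 : x ^ 2 / a * q / (p i * x / a) = x * q / p i := by field_simp
    have e2 : q / (p i * x / a) = a * q / (p i * x) := by field_simp
    have e3 : q / (p i * x / a * q ^ n) = a * q / (p i * (x * q ^ n)) := by field_simp
    have e4 : q ^ n * (x * q / p i) = q * (x * q ^ n) / p i := by ring
    have h := qPoch_mul_qInf hq0 hq (u := p i * x / a)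
      (div_ne_zero (mul_ne_zero hpi hx) ha) (by rw [e2]; exact h2 i) n
    rw [e2, e3] at h
    rw [e1, inv_qPoch hq0 hq (h1 i), e4]
    have hc := mul_inv_cancel₀ (h1 i)
    linear_combination (qInf q (q * (x * q ^ n) / p i)) * h
      + qPoch q (p i * x / a) n * qInf q (q * (x * q ^ n) / p i) * qInf q (a * q / (p i * x)) * hc
  have h3 := Finset.prod_congr (rfl : (Finset.univ : Finset (Fin 6)) = _) fun i _ => hi i
  rw [Finset.prod_mul_distrib, Finset.prod_mul_distrib (g := fun _ => q ^ (n * (n - 1) / 2)),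
    Finset.prod_mul_distrib (g := fun i => (-(p i * x / a)) ^ n), Finset.prod_zpow,
    Finset.prod_const] at h3
  have e5 : ∏ i, -(p i * x / a) = (∏ i, p i) * (x / a) ^ 6 := by
    simp only [Fin.prod_univ_six]; ring
  have e6 : (q ^ (n * (n - 1) / 2)) ^ (Finset.univ : Finset (Fin 6)).card
      = q ^ (3 * n ^ 2) * (q ^ (3 * n))⁻¹ := by
    rw [Finset.card_univ, Fintype.card_fin, ← zpow_natCast, ← zpow_mul, ← zpow_neg, ← zpow_add₀ hq0]
    congr 1
    have := Int.ediv_mul_cancel (even_iff_two_dvd.1 (Int.even_mul_pred_self n))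
    push_cast
    linear_combination 3 * this
  rw [e5, e6] at h3
  -- The six reflections produced `q^{3n² - 3n}` and `(∏ p_i (x/a)^6)^n`. Against `wpArg ^ n` the
  -- parameters cancel; this is the origin of the factor `(x²/a)^{3n}` in `wpTerm`.
  have e7 : ((∏ i, p i) * (x / a) ^ 6) ^ n * (q ^ (3 * n))⁻¹ * wpArg q a p ^ n
      = (x ^ 2 / a) ^ (3 * n) * (q ^ n)⁻¹ := by
    have e3 : (3 * n : ℤ) = ((3 : ℕ) : ℤ) * n := by norm_num
    rw [e3, zpow_mul q, zpow_mul (x ^ 2 / a), zpow_natCast, zpow_natCast, ← inv_zpow (q ^ 3) n,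
      ← inv_zpow q n, ← mul_zpow, ← mul_zpow, ← mul_zpow, wpArg]
    congr 1
    field_simp
  have e8 : x * ((x * q ^ n)⁻¹ - x * q ^ n / a) = (1 - x ^ 2 / a * (q ^ n) ^ 2) * (q ^ n)⁻¹ := by
    field_simp
  rw [wpTerm]
  rw [div_mul_eq_mul_div (1 - x ^ 2 / a * (q ^ n) ^ 2) (1 - x ^ 2 / a),
    div_mul_eq_mul_div _ (1 - x ^ 2 / a), div_mul_eq_mul_div x, div_eq_div_iff hA1 (mul_ne_zero hA1 hD)]
  linear_combination (1 - x ^ 2 / a) * (1 - x ^ 2 / a * (q ^ n) ^ 2) * wpArg q a p ^ n * h3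
    + (1 - x ^ 2 / a) * (1 - x ^ 2 / a * (q ^ n) ^ 2)
      * (∏ i, (qInf q (q * (x * q ^ n) / p i) * qInf q (a * q / (p i * (x * q ^ n)))))
      * q ^ (3 * n ^ 2) * e7
    - (1 - x ^ 2 / a)
      * (∏ i, (qInf q (q * (x * q ^ n) / p i) * qInf q (a * q / (p i * (x * q ^ n)))))
      * q ^ (3 * n ^ 2) * (x ^ 2 / a) ^ (3 * n) * e8

end Identification

/-! ### Termination at a parameter and the unilateral series -/

section Unilateral

variable {q a x : ℂ} {p : Fin 6 → ℂ}

/-- The terms of the regularised unilateral series. -/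
def uniTerm (q a : ℂ) (p : Fin 6 → ℂ) (m : ℕ) (x : ℂ) : ℂ :=
  (1 - x ^ 2 / a * q ^ (2 * m)) * wpArg q a p ^ m
    * ∏ i, (qInf q (x * q / p i * q ^ m) * (∏ j ∈ Finset.range m, (1 - x * p i / a * q ^ j)))

/-- The regularised unilateral series. -/
def uniSum (q a : ℂ) (p : Fin 6 → ℂ) (x : ℂ) : ℂ := ∑' m : ℕ, uniTerm q a p m x

theorem mul_wpTerm_natCast (hq0 : q ≠ 0) (hq : ‖q‖ < 1) (ha : a ≠ 0) (hx : x ≠ 0)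
    (hp : ∀ i, p i ≠ 0) (m : ℕ) :
    x * wpTerm q a p m x = (∏ i, qInf q (a * q / (p i * x))) * uniTerm q a p m x := by
  rw [wpTerm_natCast hq0 hq ha hx hp, uniTerm, Finset.prod_mul_distrib (g := fun i => qInf q _)]
  field_simp

/-- At a parameter the bilateral sum terminates on one side. -/
theorem mul_wpSum_parameter (hq0 : q ≠ 0) (hq : ‖q‖ < 1) (ha : a ≠ 0) (hp : ∀ i, p i ≠ 0)
    (hw : ‖wpArg q a p‖ < 1) (i : Fin 6) :
    p i * wpSum q a p (p i) = (∏ j, qInf q (a * q / (p j * p i))) * uniSum q a p (p i) := by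
  have hs := summable_wpTerm hq0 hq ha (hp i) hp hw
  -- At `x = p i` the `i`-th factor contains `(q^{-n};q)_∞ = 0` at the index `-(n+1)`.
  have h0 : ∀ n : ℕ, wpTerm q a p (-((n : ℤ) + 1)) (p i) = 0 := by
    intro n
    rw [wpTerm, Finset.prod_eq_zero (Finset.mem_univ i)]
    · simp
    · rw [qInf_eq_zero hq (n := n), zero_mul]
      have := hp i
      rw [zpow_neg, zpow_add_one₀ hq0, zpow_natCast]
      field_simp
  have hs1 : Summable fun n : ℕ => wpTerm q a p (n : ℤ) (p i) :=
    hs.comp_injective (i := fun n : ℕ => (n : ℤ)) Nat.cast_injective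
  have hs2 : Summable fun n : ℕ => wpTerm q a p (-((n : ℤ) + 1)) (p i) := by
    rw [funext h0]; exact summable_zero
  have h := tsum_of_nat_of_neg_add_one (f := fun n : ℤ => wpTerm q a p n (p i)) hs1 hs2
  rw [tsum_congr h0, tsum_zero, add_zero] at h
  rw [wpSum, h, uniSum, ← tsum_mul_left, ← tsum_mul_left]
  exact tsum_congr fun m => mul_wpTerm_natCast hq0 hq ha (hp i) hp m

theorem norm_uniTerm_le (hq : ‖q‖ < 1) (m : ℕ) :
    ‖uniTerm q a p m x‖ ≤ (1 + ‖x ^ 2 / a‖) * (∏ i, (Real.exp (‖x * q / p i‖ / (1 - ‖q‖))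
      * Real.exp (‖x * p i / a‖ / (1 - ‖q‖)))) * ‖wpArg q a p‖ ^ m := by
  rw [uniTerm, norm_mul, norm_mul, norm_pow, mul_right_comm, norm_prod]
  gcongr with i
  · exact norm_one_sub_mul_pow_le hq _ _
  · rw [norm_mul]
    gcongr
    · exact norm_qInf_mul_pow_le hq _ _
    · exact norm_prod_one_sub_le hq _ _

theorem summable_uniTerm (hq : ‖q‖ < 1) (hw : ‖wpArg q a p‖ < 1) :
    Summable fun m => uniTerm q a p m x :=
  ((summable_geometric_of_lt_one (norm_nonneg _) hw).mul_left _).of_norm_bounded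
    fun m => norm_uniTerm_le hq m

theorem continuousOn_wpArg {X : Type*} [TopologicalSpace X] {U : Set X} {P : X → Fin 6 → ℂ}
    (hP : ∀ i, ContinuousOn (fun y => P y i) U) (hP0 : ∀ y ∈ U, ∀ i, P y i ≠ 0) :
    ContinuousOn (fun y => wpArg q a (P y)) U :=
  continuousOn_const.div (continuousOn_finsetProd _ fun i _ => hP i) fun y hy =>
    Finset.prod_ne_zero_iff.2 fun i _ => hP0 y hy i

theorem continuousOn_uniSum (hq : ‖q‖ < 1)
    {X : Type*} [TopologicalSpace X] {U : Set X} (hU : IsOpen U) {u : X → ℂ}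
    {P : X → Fin 6 → ℂ} (hu : ContinuousOn u U) (hP : ∀ i, ContinuousOn (fun y => P y i) U)
    (hP0 : ∀ y ∈ U, ∀ i, P y i ≠ 0) (hw : ∀ y ∈ U, ‖wpArg q a (P y)‖ < 1) :
    ContinuousOn (fun y => uniSum q a (P y) (u y)) U := by
  have hw' := continuousOn_wpArg (q := q) (a := a) hP hP0
  have d1 : ∀ i, ContinuousOn (fun y => u y * q / P y i) U := fun i =>
    (hu.mul continuousOn_const).div (hP i) fun y hy => hP0 y hy i
  have d2 : ∀ i, ContinuousOn (fun y => u y * P y i / a) U := fun i => (hu.mul (hP i)).div_const a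
  refine continuousOn_tsum_geometric (v := id) (fun ρ => summable_geometric_of_lt_one) hU
    (fun m => ?_) ?_ hw'.norm (fun y _ => ?_) (fun y _ => norm_nonneg _) hw
    (fun m y _ => norm_uniTerm_le hq m)
  · unfold uniTerm
    refine ((continuousOn_const.sub (((hu.pow 2).div_const a).mul continuousOn_const)).mul
      (hw'.pow m)).mul (continuousOn_finsetProd _ fun i _ => ContinuousOn.mul ?_ ?_)
    · exact (continuous_qInf hq).comp_continuousOn ((d1 i).mul continuousOn_const)
    · exact continuousOn_finsetProd _ fun j _ =>
        continuousOn_const.sub ((d2 i).mul continuousOn_const)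
  · exact (continuousOn_const.add ((hu.pow 2).div_const a).norm).mul
      (continuousOn_finsetProd _ fun i _ =>
        (((d1 i).norm).div_const _).rexp.mul (((d2 i).norm).div_const _).rexp)
  · positivity

/-- The unilateral series as a normalised `uniSum`. -/
theorem WTerm_eq_uniTerm (hq0 : q ≠ 0) (hq : ‖q‖ < 1) (ha : a ≠ 0) (hp : ∀ i, p i ≠ 0)
    (hA : ∀ n : ℕ, p 0 ^ 2 / a * q ^ (2 * n) ≠ 1)
    (h1 : ∀ i, qInf q (p 0 * q / p i) ≠ 0) (n : ℕ) :
    WTerm q (p 0 ^ 2 / a)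
      [p 0 * p 1 / a, p 0 * p 2 / a, p 0 * p 3 / a, p 0 * p 4 / a, p 0 * p 5 / a] (wpArg q a p) n
      = ((1 - p 0 ^ 2 / a) * ∏ i, qInf q (p 0 * q / p i))⁻¹ * uniTerm q a p n (p 0) := by
  have h0 := hp 0
  have hA0 : p 0 ^ 2 / a ≠ 0 := div_ne_zero (pow_ne_zero _ h0) ha
  have hs : ((p 0 ^ 2 / a) ^ (1 / 2 : ℂ)) ^ 2 = p 0 ^ 2 / a := by
    rw [one_div]; exact Complex.cpow_nat_inv_pow _ two_ne_zero
  have hs0 : (p 0 ^ 2 / a) ^ (1 / 2 : ℂ) ≠ 0 := fun h => hA0 (by rw [← hs, h]; simp)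
  have hv := qPoch_veryWellPoised hq0 hq hs hs0 n hA (fun k hk => hA (n + k) (by
    rw [← hk, zpow_natCast, ← pow_add, pow_mul']))
  have hi : ∀ i, qPoch q (p 0 * p i / a) n * (qPoch q (p 0 ^ 2 / a * q / (p 0 * p i / a)) n)⁻¹
      = (qInf q (p 0 * q / p i * q ^ n) * (∏ j ∈ Finset.range n, (1 - p 0 * p i / a * q ^ j)))
        * (qInf q (p 0 * q / p i))⁻¹ := by
    intro i
    have hpi := hp i
    have e : p 0 ^ 2 / a * q / (p 0 * p i / a) = p 0 * q / p i := by field_simp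
    rw [e, inv_qPoch hq0 hq (h1 i), qPoch_natCast, zpow_natCast, mul_comm (q ^ n)]
    ring
  have hprod := Finset.prod_congr (rfl : (Finset.univ : Finset (Fin 6)) = _) fun i _ => hi i
  rw [Finset.prod_mul_distrib (g := fun i => (qInf q (p 0 * q / p i))⁻¹),
    Finset.prod_inv_distrib] at hprod
  -- The index `0` supplies `(A;q)_n / (q;q)_n` with `A = p 0 ^ 2 / a`, the pair that a `W` series
  -- has beyond its five free parameters.
  have e0 : p 0 ^ 2 / a * q / (p 0 * p 0 / a) = q := by field_simp
  have e0' : p 0 * p 0 / a = p 0 ^ 2 / a := by ring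
  rw [Fin.prod_univ_six, e0, e0'] at hprod
  rw [zpow_natCast, ← pow_mul' q 2 n] at hv
  have : WTerm q (p 0 ^ 2 / a)
      [p 0 * p 1 / a, p 0 * p 2 / a, p 0 * p 3 / a, p 0 * p 4 / a, p 0 * p 5 / a] (wpArg q a p) n
      = (1 - p 0 ^ 2 / a * q ^ (2 * n)) / (1 - p 0 ^ 2 / a) * wpArg q a p ^ n *
        ((∏ i, (qInf q (p 0 * q / p i * q ^ n) *
          (∏ j ∈ Finset.range n, (1 - p 0 * p i / a * q ^ j))))
          * (∏ i, qInf q (p 0 * q / p i))⁻¹) := by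
    rw [← hprod, ← hv]
    simp only [WTerm, phiTerm, vwpUpper, vwpLower, qPochL, List.map_cons, List.map_nil,
      List.prod_cons, List.prod_nil, div_eq_mul_inv, mul_inv]
    ring
  rw [this, uniTerm, mul_inv]
  ring

end Unilateral

/-! ### The connection formula at `x = b`, for all admissible `b` -/

section Connection

variable {q a b c d e h k z : ℂ}

/-- These `b` are square roots of `a q^{n+1}`. Countability makes the complement dense, as the
continuity argument requires. -/
theorem countable_setOf_qInf_sq_eq_zero (hq : ‖q‖ < 1) :
    {b : ℂ | b ≠ 0 ∧ qInf q (a * q / (b * b)) = 0}.Countable := by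
  have hsub : {b : ℂ | b ≠ 0 ∧ qInf q (a * q / (b * b)) = 0} ⊆
      ⋃ n : ℕ, {(a * q ^ (n + 1)) ^ (1 / 2 : ℂ), -(a * q ^ (n + 1)) ^ (1 / 2 : ℂ)} := by
    rintro b ⟨hb, h0⟩
    obtain ⟨n, hn⟩ := exists_of_qInf_eq_zero hq h0
    refine Set.mem_iUnion.2 ⟨n, ?_⟩
    have hs : ((a * q ^ (n + 1)) ^ (1 / 2 : ℂ)) ^ 2 = a * q ^ (n + 1) := by
      rw [one_div]; exact Complex.cpow_nat_inv_pow _ two_ne_zero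
    have : b ^ 2 = ((a * q ^ (n + 1)) ^ (1 / 2 : ℂ)) ^ 2 := by
      rw [hs]
      field_simp at hn
      rw [← hn]; ring
    simpa using sq_eq_sq_iff_eq_or_eq_neg.1 this
  exact (Set.countable_iUnion fun n => (Set.toFinite _).countable).mono hsub

/-- The right-hand side of the connection formula in regularised form. -/
def connectionSum (q a z : ℂ) (p : Fin 6 → ℂ) (x : ℂ) : ℂ :=
  a * wpSum q a p a / thetaProd q a * (thetaProd q (x * z / a) * thetaProd q (z / x)
      / (thetaProd q (z / a) * thetaProd q z))
    + z * wpSum q a p z / thetaProd q (z ^ 2 / a) * (thetaProd q (a / x) * thetaProd q x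
      / (thetaProd q (a / z) * thetaProd q z))

theorem continuousOn_thetaProd_comp (hq : ‖q‖ < 1) {X : Type*} [TopologicalSpace X] {U : Set X}
    {u : X → ℂ} (hu : ContinuousOn u U) (hu0 : ∀ y ∈ U, u y ≠ 0) :
    ContinuousOn (fun y => thetaProd q (u y)) U :=
  ((continuous_qInf hq).comp_continuousOn hu).mul
    ((continuous_qInf hq).comp_continuousOn (continuousOn_const.div hu hu0))

/-- The connection formula in regularised form, valid also where `θ(b² / a)` vanishes. -/
theorem uniSum_connection (hq0 : q ≠ 0) (hq : ‖q‖ < 1) (ha0 : a ≠ 0) (hz0 : z ≠ 0)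
    (ha : ∀ m : ℤ, a ≠ q ^ m) (hza : ∀ m : ℤ, z ^ 2 / a ≠ q ^ m)
    (hz : ∀ m : ℤ, z ≠ q ^ m ∧ z / a ≠ q ^ m)
    (hb : b ≠ 0) (hc : c ≠ 0) (hd : d ≠ 0) (he : e ≠ 0) (hh : h ≠ 0) (hk : k ≠ 0)
    (hw : ‖wpArg q a ![b, c, d, e, h, k]‖ < 1) :
    (qInf q (a * q / (c * b)) * qInf q (a * q / (d * b)) * qInf q (a * q / (e * b))
        * qInf q (a * q / (h * b)) * qInf q (a * q / (k * b))) * uniSum q a ![b, c, d, e, h, k] b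
      = qInf q (b ^ 2 / a) * connectionSum q a z ![b, c, d, e, h, k] b := by
  set P : ℂ → Fin 6 → ℂ := fun b => ![b, c, d, e, h, k] with hPdef
  have hP0 : ∀ y, y ≠ 0 → ∀ i, P y i ≠ 0 := by
    intro y hy i
    fin_cases i <;> assumption
  have hPc : ∀ (U : Set ℂ) (i : Fin 6), ContinuousOn (fun y => P y i) U := by
    intro U i
    fin_cases i
    · exact continuousOn_id
    all_goals exact continuousOn_const
  -- Only the first parameter varies; `U` is the open set of its nonzero values for which the series
  -- still converge.
  set U : Set ℂ := {0}ᶜ ∩ (fun y => ‖wpArg q a (P y)‖) ⁻¹' Set.Iio 1 with hUdef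
  have hU : IsOpen U :=
    ((continuousOn_wpArg (hPc _) fun y hy => hP0 y hy).norm).isOpen_inter_preimage
      isOpen_compl_singleton isOpen_Iio
  have hU0 : ∀ y ∈ U, y ≠ 0 := fun y hy => hy.1
  have hUP : ∀ y ∈ U, ∀ i, P y i ≠ 0 := fun y hy => hP0 y (hU0 y hy)
  have hUw : ∀ y ∈ U, ‖wpArg q a (P y)‖ < 1 := fun y hy => hy.2
  have hD := (countable_setOf_qInf_sq_eq_zero (a := a) hq).dense_compl ℂ
  -- Both `mul_wpSum_parameter` and `θ(y²/a)` contribute the factor `(aq/y²;q)_∞`, which is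
  -- cancelled here and leaves `(y²/a;q)_∞` on the right.
  have key : ∀ y ∈ U, qInf q (a * q / (y * y)) ≠ 0 →
      (qInf q (a * q / (c * y)) * qInf q (a * q / (d * y)) * qInf q (a * q / (e * y))
        * qInf q (a * q / (h * y)) * qInf q (a * q / (k * y))) * uniSum q a (P y) y
      = qInf q (y ^ 2 / a) * connectionSum q a z (P y) y := by
    intro y hy hne
    have h1 := mul_wpSum_parameter hq0 hq ha0 (hUP y hy) (hUw y hy) 0
    have h2 := (isOddTheta_wpSum hq0 hq ha0 (hUP y hy) (hUw y hy)).connection hq0 hq ha0 hz0 ha hza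
      hz (hU0 y hy)
    rw [Fin.prod_univ_six] at h1
    change y * wpSum q a (P y) y = (qInf q (a * q / (y * y)) * qInf q (a * q / (c * y))
      * qInf q (a * q / (d * y)) * qInf q (a * q / (e * y)) * qInf q (a * q / (h * y))
      * qInf q (a * q / (k * y))) * uniSum q a (P y) y at h1
    change _ = _ * connectionSum q a z (P y) y at h2
    rw [h1, thetaProd] at h2
    have e1 : q / (y ^ 2 / a) = a * q / (y * y) := by
      have := hU0 y hy
      field_simp
    rw [e1] at h2
    refine mul_left_cancel₀ hne ?_
    linear_combination h2
  have hclos : U ⊆ closure (U ∩ {b : ℂ | b ≠ 0 ∧ qInf q (a * q / (b * b)) = 0}ᶜ) :=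
    hD.open_subset_closure_inter hU
  have hidc : ContinuousOn (fun y : ℂ => y) U := continuousOn_id
  have cq : ∀ s : ℂ, s ≠ 0 → ContinuousOn (fun y => qInf q (a * q / (s * y))) U := fun s hs =>
    (continuous_qInf hq).comp_continuousOn (continuousOn_const.div (continuousOn_const.mul hidc)
      fun y hy => mul_ne_zero hs (hU0 y hy))
  have cH : ∀ x : ℂ, x ≠ 0 → ContinuousOn (fun y => wpSum q a (P y) x) U := fun x hx =>
    continuousOn_wpSum hq0 hq ha0 hx hU (hPc U) hUP hUw
  have hEq := Set.EqOn.of_subset_closure (t := U)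
    (s := U ∩ {b : ℂ | b ≠ 0 ∧ qInf q (a * q / (b * b)) = 0}ᶜ)
    (f := fun y => (qInf q (a * q / (c * y)) * qInf q (a * q / (d * y)) * qInf q (a * q / (e * y))
        * qInf q (a * q / (h * y)) * qInf q (a * q / (k * y))) * uniSum q a (P y) y)
    (g := fun y => qInf q (y ^ 2 / a) * connectionSum q a z (P y) y)
    (fun y hy => key y hy.1 fun h0 => hy.2 ⟨hU0 y hy.1, h0⟩) ?_ ?_ Set.inter_subset_left hclos
  · exact hEq (show b ∈ U from ⟨hb, hw⟩)
  · exact (((((cq c hc).mul (cq d hd)).mul (cq e he)).mul (cq h hh)).mul (cq k hk)).mul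
      (continuousOn_uniSum hq hU hidc (hPc U) hUP hUw)
  · refine ((continuous_qInf hq).comp_continuousOn ((hidc.pow 2).div_const a)).mul ?_
    have t1 : ContinuousOn (fun y => thetaProd q (y * z / a)) U := continuousOn_thetaProd_comp hq
      ((hidc.mul continuousOn_const).div_const a)
      fun y hy => div_ne_zero (mul_ne_zero (hU0 y hy) hz0) ha0
    have t2 : ContinuousOn (fun y => thetaProd q (z / y)) U := continuousOn_thetaProd_comp hq
      (continuousOn_const.div hidc hU0) fun y hy => div_ne_zero hz0 (hU0 y hy)
    have t3 : ContinuousOn (fun y => thetaProd q (a / y)) U := continuousOn_thetaProd_comp hq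
      (continuousOn_const.div hidc hU0) fun y hy => div_ne_zero ha0 (hU0 y hy)
    have t4 : ContinuousOn (fun y => thetaProd q y) U := continuousOn_thetaProd_comp hq hidc hU0
    exact ((((cH a ha0).const_mul a).div_const _).mul ((t1.mul t2).div_const _)).add
      ((((cH z hz0).const_mul z).div_const _).mul ((t3.mul t4).div_const _))

end Connection

end

end QSeries

/-! ### The theorem: specialisation and matching of coefficients -/

theorem mainTheorem4 (q a b c d e h k z : ℂ)
    (hq0 : 0 < ‖q‖) (hq1 : ‖q‖ < 1)
    (ha0 : a ≠ 0) (hz0 : z ≠ 0)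
    (hne : ∀ x ∈ [b, c, d, e, h, k], x ≠ 0)
    (hconv : ‖a ^ 3 * q ^ 2 / (b * c * d * e * h * k)‖ < 1)
    -- no denominator vanishes in `λ₁`, `μ₁` and the three series
    (ha : ∀ m : ℤ, a ≠ q ^ m)
    (hza : ∀ m : ℤ, z ^ 2 / a ≠ q ^ m)
    (hz : ∀ m : ℤ, z ≠ q ^ m ∧ z / a ≠ q ^ m)
    (hba : ∀ n : ℕ, b ^ 2 / a * q ^ (2 * n) ≠ 1)
    (hpsi : ∀ x ∈ [b, c, d, e, h, k], ∀ n : ℕ,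
      q / x * q ^ n ≠ 1 ∧ a * q / x * q ^ n ≠ 1 ∧
      a * q / z / x * q ^ n ≠ 1 ∧ z * q / x * q ^ n ≠ 1)
    (hW : ∀ x ∈ [c, d, e, h, k], ∀ n : ℕ,
      a * q / b / x * q ^ n ≠ 1 ∧ b * q / x * q ^ n ≠ 1) :
    Summable (QSeries.WTerm q (b ^ 2 / a)
      [b * c / a, b * d / a, b * e / a, b * h / a, b * k / a]
      (a ^ 3 * q ^ 2 / (b * c * d * e * h * k))) ∧
    Summable (QSeries.vwpPsiTerm q a [b, c, d, e, h, k]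
      (a ^ 3 * q ^ 2 / (b * c * d * e * h * k))) ∧
    Summable (QSeries.vwpPsiTerm q (z ^ 2 / a)
      [b * z / a, c * z / a, d * z / a, e * z / a, h * z / a, k * z / a]
      (a ^ 3 * q ^ 2 / (b * c * d * e * h * k))) ∧
    QSeries.W q (b ^ 2 / a)
        [b * c / a, b * d / a, b * e / a, b * h / a, b * k / a]
        (a ^ 3 * q ^ 2 / (b * c * d * e * h * k))
      = QSeries.lambda₁ q a b c d e h k z
          * QSeries.vwpPsi q a [b, c, d, e, h, k]
              (a ^ 3 * q ^ 2 / (b * c * d * e * h * k))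
        + QSeries.mu₁ q a b c d e h k z
          * QSeries.vwpPsi q (z ^ 2 / a)
              [b * z / a, c * z / a, d * z / a, e * z / a, h * z / a, k * z / a]
              (a ^ 3 * q ^ 2 / (b * c * d * e * h * k)) := by
  open QSeries in
  have hq : q ≠ 0 := norm_pos_iff.1 hq0
  have hb := hne b (by simp)
  have hc := hne c (by simp)
  have hd := hne d (by simp)
  have he := hne e (by simp)
  have hh := hne h (by simp)
  have hk := hne k (by simp)
  set p : Fin 6 → ℂ := ![b, c, d, e, h, k] with hp
  have hmem : ∀ i, p i ∈ [b, c, d, e, h, k] := by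
    intro i; fin_cases i <;> simp [p]
  have hp0 : ∀ i, p i ≠ 0 := fun i => hne _ (hmem i)
  have hargw : a ^ 3 * q ^ 2 / (b * c * d * e * h * k) = wpArg q a p := by
    rw [wpArg, Fin.prod_univ_six]; rfl
  rw [hargw] at hconv ⊢
  have nW : ∀ i, qInf q (b * q / p i) ≠ 0 := by
    intro i
    by_cases hi : p i = b
    · rw [hi, mul_div_cancel_left₀ _ hb]; exact qInf_q_ne_zero hq1
    · refine qInf_ne_zero hq1 fun n => (hW _ ?_ n).2
      simpa [hi] using hmem i
  have n1 : ∀ i, qInf q (a * q / p i) ≠ 0 := fun i =>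
    qInf_ne_zero hq1 fun n => (hpsi _ (hmem i) n).2.1
  have n2 : ∀ i, qInf q (q / p i) ≠ 0 := fun i => qInf_ne_zero hq1 fun n => (hpsi _ (hmem i) n).1
  have n3 : ∀ i, qInf q (z * q / p i) ≠ 0 := fun i =>
    qInf_ne_zero hq1 fun n => (hpsi _ (hmem i) n).2.2.2
  have n4 : ∀ i, qInf q (a * q / z / p i) ≠ 0 := fun i =>
    qInf_ne_zero hq1 fun n => (hpsi _ (hmem i) n).2.2.1
  have n5 : ∀ i, i ≠ 0 → qInf q (a * q / b / p i) ≠ 0 := by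
    intro i hi
    refine qInf_ne_zero hq1 fun n => (hW _ ?_ n).1
    fin_cases i <;> simp [p] at hi ⊢
  have ea : ∀ i, a * q / (p i * a) = q / p i := fun i => by
    have := hp0 i
    field_simp
  have ez : ∀ x i, a * q / (p i * x) = a * q / x / p i := fun x i => by rw [div_div, mul_comm x]
  have eaa : a ^ 2 / a = a := by field_simp
  have eap : ∀ s, s * a / a = s := fun s => mul_div_cancel_right₀ _ ha0
  -- the three series in regularised form
  have tW : WTerm q (b ^ 2 / a) [b * c / a, b * d / a, b * e / a, b * h / a, b * k / a] (wpArg q a p)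
      = fun n => ((1 - b ^ 2 / a) * ∏ i, qInf q (b * q / p i))⁻¹ * uniTerm q a p n b :=
    funext fun n => WTerm_eq_uniTerm hq hq1 ha0 hp0 hba nW n
  -- Base point `x = a`: then `x² / a = a` and `p_i x / a = p_i`.
  have tA : vwpPsiTerm q a [b, c, d, e, h, k] (wpArg q a p)
      = fun n => a / ((1 - a) * ∏ i, (qInf q (a * q / p i) * qInf q (q / p i)))
        * wpTerm q a p n a := by
    funext n
    have := vwpPsiTerm_eq_wpTerm hq hq1 ha0 ha0 hp0 (by rwa [eaa]) n1
      (fun i => by rw [ea]; exact n2 i) n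
    simp only [eaa, eap, ea] at this
    exact this
  have tZ : vwpPsiTerm q (z ^ 2 / a)
      [b * z / a, c * z / a, d * z / a, e * z / a, h * z / a, k * z / a] (wpArg q a p)
      = fun n => z / ((1 - z ^ 2 / a) * ∏ i, (qInf q (z * q / p i) * qInf q (a * q / z / p i)))
        * wpTerm q a p n z := by
    funext n
    have := vwpPsiTerm_eq_wpTerm hq hq1 ha0 hz0 hp0 hza n3
      (fun i => by rw [ez]; exact n4 i) n
    simp only [ez] at this
    exact this
  refine ⟨?_, ?_, ?_, ?_⟩
  · rw [tW]; exact (summable_uniTerm hq1 hconv).mul_left _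
  · rw [tA]; exact (summable_wpTerm hq hq1 ha0 ha0 hp0 hconv).mul_left _
  · rw [tZ]; exact (summable_wpTerm hq hq1 ha0 hz0 hp0 hconv).mul_left _
  have sW : W q (b ^ 2 / a) [b * c / a, b * d / a, b * e / a, b * h / a, b * k / a] (wpArg q a p)
      = ((1 - b ^ 2 / a) * ∏ i, qInf q (b * q / p i))⁻¹ * uniSum q a p b := by
    rw [W, tW, tsum_mul_left]; rfl
  have sA : vwpPsi q a [b, c, d, e, h, k] (wpArg q a p)
      = a / ((1 - a) * ∏ i, (qInf q (a * q / p i) * qInf q (q / p i))) * wpSum q a p a := by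
    rw [vwpPsi, tA, tsum_mul_left]; rfl
  have sZ : vwpPsi q (z ^ 2 / a)
      [b * z / a, c * z / a, d * z / a, e * z / a, h * z / a, k * z / a] (wpArg q a p)
      = z / ((1 - z ^ 2 / a) * ∏ i, (qInf q (z * q / p i) * qInf q (a * q / z / p i)))
        * wpSum q a p z := by
    rw [vwpPsi, tZ, tsum_mul_left]; rfl
  have hreg := uniSum_connection hq hq1 ha0 hz0 ha hza hz hb hc hd he hh hk hconv
  rw [← hp] at hreg
  have hza0 : z ^ 2 / a ≠ 0 := div_ne_zero (pow_ne_zero _ hz0) ha0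
  have hA1 : 1 - b ^ 2 / a ≠ 0 := fun h0 => hba 0 (by simp; linear_combination -h0)
  have ha1 : 1 - a ≠ 0 := fun h0 => ha 0 (by rw [zpow_zero]; linear_combination -h0)
  have hz1 : 1 - z ^ 2 / a ≠ 0 := fun h0 => hza 0 (by rw [zpow_zero]; linear_combination -h0)
  have θa : thetaProd q a = (1 - a) * qInf q (a * q) * qInf q (q / a) := by
    rw [thetaProd, qInf_eq_mul hq1 a, mul_comm q a]
  have θz : thetaProd q (z ^ 2 / a) = (1 - z ^ 2 / a) * qInf q (z ^ 2 * q / a)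
      * qInf q (a * q / z ^ 2) := by
    rw [thetaProd, qInf_eq_mul hq1 (z ^ 2 / a), show q * (z ^ 2 / a) = z ^ 2 * q / a by ring,
      show q / (z ^ 2 / a) = a * q / z ^ 2 by rw [div_div_eq_mul_div, mul_comm]]
  have hb1 : qInf q (b ^ 2 / a) = (1 - b ^ 2 / a) * qInf q (b ^ 2 * q / a) := by
    rw [qInf_eq_mul hq1 (b ^ 2 / a), show q * (b ^ 2 / a) = b ^ 2 * q / a by ring]
  have m1 : thetaProd q a ≠ 0 := thetaProd_ne_zero hq hq1 ha0 ha
  have m2 : thetaProd q (z ^ 2 / a) ≠ 0 := thetaProd_ne_zero hq hq1 hza0 hza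
  obtain ⟨K, hK0, hK⟩ := exists_theta_eq hq hq1
  have r1 : thetaL q [b * z / a, z / b] / thetaL q [z / a, z]
      = thetaProd q (b * z / a) * thetaProd q (z / b) / (thetaProd q (z / a) * thetaProd q z) := by
    simp only [thetaL, List.map_cons, List.map_nil, List.prod_cons, List.prod_nil, mul_one]
    rw [hK _ (div_ne_zero (mul_ne_zero hb hz0) ha0), hK _ (div_ne_zero hz0 hb),
      hK _ (div_ne_zero hz0 ha0), hK _ hz0, mul_mul_mul_comm K,
      mul_mul_mul_comm K _ K (thetaProd q z),      mul_div_mul_left _ _ (mul_ne_zero hK0 hK0)]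
  have r2 : thetaL q [a / b, b] / thetaL q [a / z, z]
      = thetaProd q (a / b) * thetaProd q b / (thetaProd q (a / z) * thetaProd q z) := by
    simp only [thetaL, List.map_cons, List.map_nil, List.prod_cons, List.prod_nil, mul_one]
    rw [hK _ (div_ne_zero ha0 hb), hK _ hb,
      hK _ (div_ne_zero ha0 hz0), hK _ hz0, mul_mul_mul_comm K,
      mul_mul_mul_comm K _ K (thetaProd q z),      mul_div_mul_left _ _ (mul_ne_zero hK0 hK0)]
  have o1 : Omega q [q, a * q] [b, c, d, e, h, k]
      = ∏ i, (qInf q (a * q / p i) * qInf q (q / p i)) := by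
    rw [Finset.prod_mul_distrib, Fin.prod_univ_six, Fin.prod_univ_six]
    simp [Omega, p]
    ring
  have o2 : Omega q [a * q / z, z * q] [b, c, d, e, h, k]
      = ∏ i, (qInf q (z * q / p i) * qInf q (a * q / z / p i)) := by
    rw [Finset.prod_mul_distrib, Fin.prod_univ_six, Fin.prod_univ_six]
    simp [Omega, p]
    ring
  -- The product over all six parameters has the extra factor `(bq/b;q)_∞ = (q;q)_∞`, which cancels
  -- the `(q;q)_∞` in the denominators of `lambda₁` and `mu₁`.
  have o3 : qInf q q * Omega q [a * q / b, b * q] [c, d, e, h, k]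
      = (qInf q (a * q / (c * b)) * qInf q (a * q / (d * b)) * qInf q (a * q / (e * b))
        * qInf q (a * q / (h * b)) * qInf q (a * q / (k * b))) * ∏ i, qInf q (b * q / p i) := by
    rw [Fin.prod_univ_six]
    simp only [mul_comm _ b, ← div_div (a * q) b]
    simp [Omega, p, hb]
    ring
  have g1 : (∏ i, (qInf q (a * q / p i) * qInf q (q / p i))) ≠ 0 :=
    Finset.prod_ne_zero_iff.2 fun i _ => mul_ne_zero (n1 i) (n2 i)
  have g2 : (∏ i, (qInf q (z * q / p i) * qInf q (a * q / z / p i))) ≠ 0 :=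
    Finset.prod_ne_zero_iff.2 fun i _ => mul_ne_zero (n3 i) (n4 i)
  have g3 : (∏ i, qInf q (b * q / p i)) ≠ 0 := Finset.prod_ne_zero_iff.2 fun i _ => nW i
  have g4 : (qInf q (a * q / (c * b)) * qInf q (a * q / (d * b)) * qInf q (a * q / (e * b))
        * qInf q (a * q / (h * b)) * qInf q (a * q / (k * b))) ≠ 0 := by
    have n5' : ∀ i, i ≠ 0 → qInf q (a * q / (p i * b)) ≠ 0 := fun i hi => by
      rw [ez]; exact n5 i hi
    exact mul_ne_zero (mul_ne_zero (mul_ne_zero (mul_ne_zero (n5' 1 (by decide))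
      (n5' 2 (by decide))) (n5' 3 (by decide))) (n5' 4 (by decide))) (n5' 5 (by decide))
  rw [sW, sA, sZ, lambda₁, mu₁, r1, r2, o1, o2]
  simp only [qInfL, List.map_cons, List.map_nil, List.prod_cons, List.prod_nil, mul_one]
  rw [connectionSum, hb1, θa, θz] at hreg
  rw [θa] at m1
  rw [θz] at m2
  have hqq := qInf_q_ne_zero hq1
  have g5 : Omega q [a * q / b, b * q] [c, d, e, h, k] ≠ 0 :=
    right_ne_zero_of_mul (a := qInf q q) (by rw [o3]; exact mul_ne_zero g4 g3)
  have hU := eq_div_of_mul_eq g4 ((mul_comm _ _).trans hreg)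
  have hG := eq_div_of_mul_eq hqq ((mul_comm _ _).trans o3)
  have f1 := right_ne_zero_of_mul m1
  have f2 := right_ne_zero_of_mul (left_ne_zero_of_mul m1)
  have f3 := right_ne_zero_of_mul m2
  have f4 := right_ne_zero_of_mul (left_ne_zero_of_mul m2)
  rw [hU, hG]
  -- With `uniSum` and the lower `Omega` solved for, the goal is a rational identity in independent
  -- nonvanishing quantities, the theta quotients and the two values of `wpSum`.
  clear_value p
  clear hU hG hreg o3 g5 m1 m2
  generalize thetaProd q (b * z / a) * thetaProd q (z / b) / (thetaProd q (z / a) * thetaProd q z)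
    = T1
  generalize thetaProd q (a / b) * thetaProd q b / (thetaProd q (a / z) * thetaProd q z) = T2
  generalize (qInf q (a * q / (c * b)) * qInf q (a * q / (d * b)) * qInf q (a * q / (e * b))
        * qInf q (a * q / (h * b)) * qInf q (a * q / (k * b))) = G4 at *
  generalize (∏ i, qInf q (b * q / p i)) = G3 at *
  generalize (∏ i, (qInf q (z * q / p i) * qInf q (a * q / z / p i))) = G2 at *
  generalize (∏ i, (qInf q (a * q / p i) * qInf q (q / p i))) = G1 at *
  generalize qInf q (q / a) = F1 at *
  generalize qInf q (a * q) = F2 at *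
  generalize qInf q (a * q / z ^ 2) = F3 at *
  generalize qInf q (z ^ 2 * q / a) = F4 at *
  generalize 1 - b ^ 2 / a = Y1 at *
  generalize 1 - z ^ 2 / a = Y2 at *
  generalize 1 - a = Y3 at *
  generalize qInf q q = Q at *
  field_simp
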